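/- Let $p$ be a probability law on $\{0,1,2,\dots\}$ with $p(0)=0$, and let $T$ be the Galton–Watson tree with offspring law $p$ (a random rooted tree in which the numbers of children of all vertices are i.i.d. with law $p$; it has no leaves). For $\beta>0$, the $\beta$-biased random walk $(X_n)_{n\ge 0}$ on $T$ is the Markov chain on the vertices of $T$ started from the root which, from a vertex $x$ other than the root with $k$ children, moves to the parent of $x$ with probability $\frac{1}{1+\beta k}$ and to each of the $k$ children with probability $\frac{\beta}{1+\beta k}$, and which from the root moves to each of its children with equal probability. Let $|x|$ be the distance of $x$ from the root, and let $\mathbb P$ be the averaged law of the tree and the walk (the tree is drawn first, then the walk on it). Then for every $\beta\ge 717$ there is a constant $v(\beta)$, depending only on $\beta$ and $p$, such that $$\lim_{n\to\infty}\frac{|X_n|}{n}=v(\beta)\qquad \mathbb P\text{-almost surely},$$ and the speed $v(\beta)$ is strictly increasing in $\beta$ on $[717,\infty)$. -/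

import Mathlib

open MeasureTheory ProbabilityTheory Filter Topology
open scoped NNReal ENNReal

noncomputable section

namespace BiasedGW

/-- Vertices in Ulam–Harris notation: the root is `[]`, and `i :: x` is the child number `i` of `x`
(so the label of the last generation comes first). The parent of `i :: x` is `x`, and the distance
of `x` from the root is `x.length`. -/
abbrev Vertex : Type := List ℕ

instance : MeasurableSpace (List ℕ) := ⊤

instance : DiscreteMeasurableSpace (List ℕ) := ⟨fun _ => trivial⟩

/-- An environment gives to every label `x` a number of children `ω x`. It encodes the rooted tree
which contains the root and, with every vertex `x`, exactly the children `i :: x` with `i < ω x`.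
(The values of `ω` at labels outside of this tree play no role.) -/
abbrev Env : Type := Vertex → ℕ

/-- The law of the Galton–Watson tree with offspring law `p`: the numbers of children are i.i.d.
with law `p`. -/
def gwLaw (p : PMF ℕ) : Measure Env := Measure.infinitePi fun _ : Vertex => p.toMeasure

instance (p : PMF ℕ) : IsProbabilityMeasure (gwLaw p) := by
  unfold gwLaw; infer_instance

/-- The law of one step of the `β`-biased walk from a vertex with `k` children: from the root
all children are equally likely; from any other vertex the walk goes to the parent with probability
`1 / (1 + β k)` and to each of the `k` children with probability `β / (1 + β k)`.
(A root without children, which does not occur on trees without leaves, is absorbing.) -/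
def stepLaw (β : ℝ≥0) (k : ℕ) : Vertex → Measure Vertex
  | [] => if k = 0 then Measure.dirac []
      else ∑ i ∈ Finset.range k, (((1 / k : ℝ≥0)) : ℝ≥0∞) • Measure.dirac [i]
  | a :: y => ((1 / (1 + β * k) : ℝ≥0) : ℝ≥0∞) • Measure.dirac y
      + ∑ i ∈ Finset.range k, ((β / (1 + β * k) : ℝ≥0) : ℝ≥0∞) • Measure.dirac (i :: a :: y)

instance (β : ℝ≥0) (k : ℕ) (x : Vertex) : IsProbabilityMeasure (stepLaw β k x) := by
  constructor
  rcases x with _ | ⟨a, y⟩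
  · by_cases hk : k = 0
    · simp [stepLaw, hk]
    · have h : (k : ℝ≥0) * (1 / k) = 1 := by field_simp
      simp only [stepLaw, hk, if_false, Measure.coe_finsetSum, Finset.sum_apply,
        Measure.smul_apply, measure_univ, smul_eq_mul, mul_one, Finset.sum_const,
        Finset.card_range, nsmul_eq_mul]
      exact_mod_cast h
  · have h : 1 / (1 + β * k) + (k : ℝ≥0) * (β / (1 + β * k)) = 1 := by field_simp
    simp only [stepLaw, Measure.coe_add, Pi.add_apply, Measure.coe_finsetSum, Finset.sum_apply,
      Measure.smul_apply, measure_univ, smul_eq_mul, mul_one, Finset.sum_const,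
      Finset.card_range, nsmul_eq_mul]
    exact_mod_cast h

/-- The transition kernel of the `β`-biased walk in the environment `ω`. -/
def stepKernel (β : ℝ≥0) (ω : Env) : Kernel Vertex Vertex where
  toFun x := stepLaw β (ω x) x
  measurable' := measurable_of_countable _

instance (β : ℝ≥0) (ω : Env) : IsMarkovKernel (stepKernel β ω) :=
  ⟨fun x => inferInstanceAs (IsProbabilityMeasure (stepLaw β (ω x) x))⟩

/-- The same kernel, as a function of the trajectory up to time `n`. -/
def pathKernel (β : ℝ≥0) (ω : Env) (n : ℕ) :
    Kernel ((i : Finset.Iic n) → Vertex) Vertex :=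
  (stepKernel β ω).comap (fun x => x ⟨n, Finset.mem_Iic.2 le_rfl⟩) (measurable_pi_apply _)

instance (β : ℝ≥0) (ω : Env) (n : ℕ) : IsMarkovKernel (pathKernel β ω n) := by
  unfold pathKernel; infer_instance

/-- The quenched law: the law, on the space of trajectories, of the Markov chain with transition
kernel `stepKernel β ω` started from the root. -/
def quenchedLaw (β : ℝ≥0) (ω : Env) : Measure (ℕ → Vertex) :=
  Kernel.trajMeasure (X := fun _ => Vertex) (Measure.dirac []) (pathKernel β ω)

instance (β : ℝ≥0) (ω : Env) : IsProbabilityMeasure (quenchedLaw β ω) := by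
  unfold quenchedLaw; infer_instance

/-- The set of trajectories that agree with `x` up to time `n`. -/
def cyl (n : ℕ) (x : ℕ → Vertex) : Set (ℕ → Vertex) := {X | ∀ i ≤ n, X i = x i}

theorem cyl_eq_preimage (n : ℕ) (x : ℕ → Vertex) :
    cyl n x = Preorder.frestrictLe (π := fun _ => Vertex) n ⁻¹'
      {Preorder.frestrictLe (π := fun _ => Vertex) n x} := by
  ext X
  simp only [cyl, Set.mem_ofPred_eq, Set.mem_preimage, Set.mem_singleton_iff, funext_iff,
    Subtype.forall, Finset.mem_Iic]
  exact Iff.rfl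

/-- The walk starts at the root. -/
theorem quenchedLaw_cyl_zero (β : ℝ≥0) (ω : Env) (x : ℕ → Vertex) :
    quenchedLaw β ω (cyl 0 x) = Measure.dirac ([] : Vertex) {x 0} := by
  have hm : MeasurableSet {Preorder.frestrictLe (π := fun _ => Vertex) 0 x} :=
    measurableSet_singleton _
  rw [cyl_eq_preimage, ← Measure.map_apply (by fun_prop) hm, quenchedLaw, Kernel.trajMeasure,
    Measure.map_comp _ _ (by fun_prop), Kernel.traj_map_frestrictLe, Kernel.partialTraj_self,
    Measure.id_comp, Measure.map_apply (by fun_prop) hm]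
  congr 1
  ext y
  simp only [Set.mem_preimage, Set.mem_singleton_iff]
  constructor
  · intro h
    exact congrFun h ⟨0, by simp⟩
  · rintro h
    funext ⟨i, hi⟩
    obtain rfl : i = 0 := by simpa using hi
    exact h

/-- The Markov property: the law of the trajectory is given by the transition probabilities. -/
theorem quenchedLaw_cyl_succ (β : ℝ≥0) (ω : Env) (x : ℕ → Vertex) (n : ℕ) :
    quenchedLaw β ω (cyl (n + 1) x) =
      quenchedLaw β ω (cyl n x) * stepLaw β (ω (x n)) (x n) {x (n + 1)} := by
  have h := Kernel.map_frestrictLe_trajMeasure_compProd_eq_map_trajMeasure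
    (X := fun _ => Vertex) (μ₀ := Measure.dirac []) (κ := pathKernel β ω) (a := n)
  have hm : MeasurableSet {Preorder.frestrictLe (π := fun _ => Vertex) n x} :=
    measurableSet_singleton _
  have h2 := congrArg (fun μ => μ ({Preorder.frestrictLe n x} ×ˢ {x (n+1)})) h
  beta_reduce at h2
  rw [Measure.compProd_apply_prod hm (measurableSet_singleton _),
    Measure.map_apply (by fun_prop) (hm.prod (measurableSet_singleton _)),
    lintegral_singleton, Measure.map_apply (by fun_prop) hm, ← cyl_eq_preimage, mul_comm] at h2
  refine Eq.trans ?_ h2.symm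
  rw [quenchedLaw]
  congr 1
  ext X
  have : X ∈ cyl n x ↔ Preorder.frestrictLe (π := fun _ => Vertex) n X =
      Preorder.frestrictLe (π := fun _ => Vertex) n x := by
    rw [cyl_eq_preimage]; rfl
  simp only [Set.mem_preimage, Set.mem_prod, Set.mem_singleton_iff]
  rw [← this]
  simp only [cyl, Set.mem_ofPred_eq]
  constructor
  · exact fun h => ⟨fun i hi => h i (by omega), h _ le_rfl⟩
  · rintro ⟨h, h'⟩ i hi
    rcases Nat.lt_or_ge n i with h3 | h3
    · obtain rfl : i = n + 1 := by omega
      exact h'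
    · exact h i h3

theorem measurable_quenchedLaw_cyl (β : ℝ≥0) (n : ℕ) (x : ℕ → Vertex) :
    Measurable fun ω => quenchedLaw β ω (cyl n x) := by
  induction n with
  | zero => simp only [quenchedLaw_cyl_zero]; exact measurable_const
  | succ n ih =>
    simp only [quenchedLaw_cyl_succ]
    refine ih.mul ?_
    exact (measurable_of_countable fun k : ℕ => stepLaw β k (x n) {x (n + 1)}).comp
      (measurable_pi_apply (x n))

theorem measurable_quenchedLaw (β : ℝ≥0) : Measurable (quenchedLaw β) := by
  refine Measurable.measure_of_isPiSystem_of_isProbabilityMeasure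
    (generateFrom_measurableCylinders (α := fun _ : ℕ => Vertex)).symm
    (isPiSystem_measurableCylinders (α := fun _ : ℕ => Vertex)) ?_
  intro s hs
  obtain ⟨n, S, -, rfl⟩ : ∃ (n : ℕ) (S : Set ((i : Finset.Iic n) → Vertex)),
      MeasurableSet S ∧ s = cylinder (Finset.Iic n) S := by
    simpa [measurableCylinders_nat] using hs
  have hc : S.Countable := S.to_countable
  have key (ω : Env) : quenchedLaw β ω (cylinder (Finset.Iic n) S) =
      ∑' y : S, quenchedLaw β ω
        (Preorder.frestrictLe (π := fun _ => Vertex) n ⁻¹' {(y : (i : Finset.Iic n) → Vertex)}) :=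
    (tsum_measure_preimage_singleton hc fun y _ =>
      (Preorder.measurable_frestrictLe n) (measurableSet_singleton y)).symm
  simp only [key]
  have : Countable S := hc.to_subtype
  refine Measurable.tsum fun y => ?_
  have hy : Preorder.frestrictLe (π := fun _ => Vertex) n
      (fun i => if h : i ≤ n then y.1 ⟨i, Finset.mem_Iic.2 h⟩ else []) = y.1 := by
    funext ⟨i, hi⟩
    simp [Finset.mem_Iic.1 hi]
  have h := measurable_quenchedLaw_cyl β n
    (fun i => if h : i ≤ n then y.1 ⟨i, Finset.mem_Iic.2 h⟩ else [])
  simp only [cyl_eq_preimage, hy] at h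
  exact h

/-- The quenched laws, as a kernel from environments to trajectories. -/
def quenchedKernel (β : ℝ≥0) : Kernel Env (ℕ → Vertex) where
  toFun := quenchedLaw β
  measurable' := measurable_quenchedLaw β

instance (β : ℝ≥0) : IsMarkovKernel (quenchedKernel β) :=
  ⟨fun ω => inferInstanceAs (IsProbabilityMeasure (quenchedLaw β ω))⟩

/-- The averaged law of the pair (tree, walk): the semi-direct product of the law of the tree and
the quenched laws of the walk. -/
def averagedLaw (p : PMF ℕ) (β : ℝ≥0) : Measure (Env × (ℕ → Vertex)) :=
  gwLaw p ⊗ₘ quenchedKernel β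

instance (p : PMF ℕ) (β : ℝ≥0) : IsProbabilityMeasure (averagedLaw p β) := by
  unfold averagedLaw; infer_instance

/-- `v` is the speed of the `β`-biased walk on the Galton–Watson tree with offspring law `p`:
`|X_n| / n` converges to the constant `v` almost surely under the averaged law. -/
def IsSpeed (p : PMF ℕ) (β : ℝ≥0) (v : ℝ) : Prop :=
  ∀ᵐ z ∂averagedLaw p β,
    Tendsto (fun n : ℕ => ((z.2 n).length : ℝ) / n) atTop (𝓝 v)

end BiasedGW

end

/-! Fix `β`. All walks with bias `β' ≥ β` are driven by one i.i.d. sequence of marks. A flag, true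
with probability `1 / (1 + β)`, allows a step back; at a vertex with `k ≥ 1` children the `β'`-walk
takes it with conditional probability `(1 + β) / (1 + β' k) ≤ 1`, so that the total probability is
correct. Each walk discovers its tree on the way and reads the degree of a new vertex off the
current mark. Degrees are i.i.d., so this yields the averaged law (`map_snd_averagedLaw`), although
two coupled walks may end up in different trees.

The flags alone define a walk `height` on the integers, and the depth of every coupled walk rises at
least as much (`height_sub_le_depth_sub`). Hence the regeneration times of `height`, which do not
involve `β'`, cut all the walks into independent blocks in fresh environment. The speed is the mean
depth at the first regeneration divided by the mean regeneration time, both under `stayLaw`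
(`tendsto_depth_div_noiseLaw`). The denominator is the same for `β` and `β'`, so it remains to
compare the numerators (`lintegral_depth_lt`).

Within a block the two walks agree until a mark separates them, which puts the faster walk two units
ahead; every later flag costs it at most two units. With `B` flags in the block the loss is at most
`2 (B - 2)`, so a loss requires `B ≥ 3`. A block of length `t` has at least `(t - 1) / 3` flags
(`IsBlock.le_backs`), and exponential moments bound the expected loss by `3 / 4` times `2 / (1 + β)`
times `meanSepProb` (`lintegral_loss_le`). Conversely, the block up, down, up, up with a separation
at the down step wins two units, which contributes `(β / (1 + β)) ^ 3` times the same two factors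
(`lintegral_gain`). Gain and loss are both proportional to `meanSepProb`, so the comparison holds
however close `β'` is to `β`. -/

noncomputable section

namespace BiasedGW

/-! ### The coupled walks, the height and its regeneration times -/

/-- The randomness of one step: a flag which allows a step back, the mark that decides whether
the allowed step back is taken, and the mark that selects a child. -/
abbrev Move : Type := Bool × ℝ × ℝ

/-- The randomness of one step, and the number of children of the current vertex in case the vertex
is visited for the first time. -/
abbrev Mark : Type := Move × ℕ

/-- The current vertex, and the vertices visited before with their numbers of children. -/
abbrev State : Type := Vertex × List (Vertex × ℕ)

instance : MeasurableSpace (List (Vertex × ℕ)) := ⊤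

instance : DiscreteMeasurableSpace (List (Vertex × ℕ)) := ⟨fun _ => trivial⟩

/-- The conditional probability that the `β'`-biased walk goes to the parent at a vertex with `k`
children, given that a step back is allowed, when this has probability `1 / (1 + β)`. -/
def backThreshold (β β' : ℝ≥0) (k : ℕ) : ℝ := (1 + β) / (1 + β' * k)

/-- The next vertex of the walk at a vertex with `k` children. -/
def move (β β' : ℝ≥0) (k : ℕ) (m : Move) : Vertex → Vertex
  | [] => if k = 0 then [] else [⌊m.2.2 * k⌋₊]
  | a :: y =>
    if k = 0 ∨ (m.1 = true ∧ m.2.1 < backThreshold β β' k) then y else ⌊m.2.2 * k⌋₊ :: a :: y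

/-- The number of children of the current vertex: it is read off the history, and it is
`max 1 d` at a new vertex. -/
def degree (s : State) (d : ℕ) : ℕ := (s.2.lookup s.1).getD (max 1 d)

/-- One step of the walk which discovers its environment. -/
def next (β β' : ℝ≥0) (s : State) (m : Mark) : State :=
  (move β β' (degree s m.2) m.1 s.1, (s.1, degree s m.2) :: s.2)

/-- The walk which discovers its environment, with its history. -/
def lazyState (β β' : ℝ≥0) (ξ : ℕ → Mark) : ℕ → State
  | 0 => ([], [])
  | n + 1 => next β β' (lazyState β β' ξ n) (ξ n)

/-- The distance of the walk from the root. -/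
def depth (β β' : ℝ≥0) (ξ : ℕ → Mark) (n : ℕ) : ℕ := (lazyState β β' ξ n).1.length

/-- The time shift. -/
def shift (t : ℕ) (ξ : ℕ → Mark) : ℕ → Mark := fun n => ξ (t + n)

/-- The nearest neighbour walk on the integers which goes down if a step back is allowed. -/
def height (ξ : ℕ → Mark) (n : ℕ) : ℤ := ∑ i ∈ Finset.range n, if (ξ i).1.1 then -1 else 1

/-- The number of times before `n` when a step back is allowed. -/
def backs (ξ : ℕ → Mark) (n : ℕ) : ℕ := ((Finset.range n).filter fun i => (ξ i).1.1 = true).card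

/-- The height never becomes negative. -/
def Stays (ξ : ℕ → Mark) : Prop := ∀ n, 0 ≤ height ξ n

/-- The height has a strict record at time `t` and never goes below it later. -/
def IsRegen (ξ : ℕ → Mark) (t : ℕ) : Prop :=
  1 ≤ t ∧ (∀ j < t, height ξ j < height ξ t) ∧ Stays (shift t ξ)

/-- Up to time `t`, the height looks like a path which stays nonnegative and whose first
regeneration is at time `t`. -/
def IsBlock (ξ : ℕ → Mark) (t : ℕ) : Prop :=
  1 ≤ t ∧ (∀ j ≤ t, 0 ≤ height ξ j) ∧ (∀ j < t, height ξ j < height ξ t) ∧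
    ∀ t', 1 ≤ t' → t' < t → (∀ j < t', height ξ j < height ξ t') →
      ∃ n, t' ≤ n ∧ n ≤ t ∧ height ξ n < height ξ t'

/-- The first regeneration time. -/
def regenTime (ξ : ℕ → Mark) : ℕ := sInf {t | IsRegen ξ t}

/-! ### Combinatorics of the height path -/

@[simp] theorem height_zero (ξ : ℕ → Mark) : height ξ 0 = 0 := rfl

theorem height_succ (ξ : ℕ → Mark) (n : ℕ) :
    height ξ (n + 1) = height ξ n + if (ξ n).1.1 then -1 else 1 := Finset.sum_range_succ _ _

theorem height_add (ξ : ℕ → Mark) (t n : ℕ) :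
    height ξ (t + n) = height ξ t + height (shift t ξ) n := Finset.sum_range_add _ _ _

@[simp] theorem backs_zero (ξ : ℕ → Mark) : backs ξ 0 = 0 := rfl

theorem backs_succ (ξ : ℕ → Mark) (n : ℕ) :
    backs ξ (n + 1) = backs ξ n + if (ξ n).1.1 then 1 else 0 := by
  unfold backs
  rw [Finset.range_add_one, Finset.filter_insert]
  split_ifs with h <;> simp

theorem height_eq (ξ : ℕ → Mark) (n : ℕ) : height ξ n = n - 2 * backs ξ n := by
  induction n with
  | zero => simp
  | succ n ih => rw [height_succ, backs_succ, ih]; split_ifs <;> push_cast <;> ring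

theorem height_congr {ξ ξ' : ℕ → Mark} {n : ℕ} (h : ∀ i < n, ξ i = ξ' i) :
    height ξ n = height ξ' n :=
  Finset.sum_congr rfl fun i hi => by rw [h i (Finset.mem_range.1 hi)]

theorem backs_le (ξ : ℕ → Mark) (n : ℕ) : backs ξ n ≤ n :=
  (Finset.card_filter_le _ _).trans (by simp)

theorem stays_shift_iff (ξ : ℕ → Mark) (t : ℕ) :
    Stays (shift t ξ) ↔ ∀ n, t ≤ n → height ξ t ≤ height ξ n := by
  constructor
  · intro h n hn
    obtain ⟨k, rfl⟩ := Nat.exists_eq_add_of_le hn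
    have := h k
    rw [height_add]; omega
  · intro h n
    have := h (t + n) (by omega)
    rw [height_add] at this; omega

theorem IsBlock.congr {ξ ξ' : ℕ → Mark} {t : ℕ} (h : ∀ i < t, ξ i = ξ' i) (hb : IsBlock ξ t) :
    IsBlock ξ' t := by
  have key : ∀ n ≤ t, height ξ n = height ξ' n := fun n hn =>
    height_congr fun i hi => h i (by omega)
  obtain ⟨h1, h2, h3, h4⟩ := hb
  refine ⟨h1, fun j hj => key j hj ▸ h2 j hj, fun j hj => ?_, fun t' ht' htt' hr => ?_⟩
  · rw [← key j hj.le, ← key t le_rfl]; exact h3 j hj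
  · obtain ⟨n, hn, hnt, hlt⟩ := h4 t' ht' htt' fun j hj => by
      rw [key j (by omega), key t' htt'.le]; exact hr j hj
    exact ⟨n, hn, hnt, by rw [← key n hnt, ← key t' htt'.le]; exact hlt⟩

/-- Factorises a global event into one about the marks before `t` and one about the marks after `t`;
the renewal structure rests on this. The last clause of `IsBlock` says that every earlier record is
undercut already by time `t`, which suffices because the path stays above its height at `t`
afterwards. -/
theorem stays_and_regenTime_eq_iff (ξ : ℕ → Mark) {t : ℕ} :
    (Stays ξ ∧ (∃ s, IsRegen ξ s) ∧ regenTime ξ = t) ↔ (IsBlock ξ t ∧ Stays (shift t ξ)) := by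
  constructor
  · rintro ⟨hs, hex, rfl⟩
    have hmem : IsRegen ξ (regenTime ξ) := Nat.sInf_mem (s := {t | IsRegen ξ t}) hex
    refine ⟨⟨hmem.1, fun j _ => hs j, hmem.2.1, fun t' h1 ht' hr => ?_⟩, hmem.2.2⟩
    by_contra! hcon
    refine Nat.notMem_of_lt_sInf ht' ⟨h1, hr, (stays_shift_iff _ _).2 fun n hn => ?_⟩
    rcases le_total n (regenTime ξ) with h | h
    · exact hcon n hn h
    · exact (hcon _ ht'.le le_rfl).trans ((stays_shift_iff _ _).1 hmem.2.2 n h)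
  · rintro ⟨⟨h1, h2, h3, h4⟩, hs⟩
    have hreg : IsRegen ξ t := ⟨h1, h3, hs⟩
    refine ⟨fun n => ?_, ⟨t, hreg⟩, ?_⟩
    · rcases le_total n t with h | h
      · exact h2 n h
      · exact (h2 t le_rfl).trans ((stays_shift_iff _ _).1 hs n h)
    · refine le_antisymm (Nat.sInf_le hreg) (le_csInf ⟨t, hreg⟩ fun t' ht' => ?_)
      by_contra! hlt
      obtain ⟨n, hn, -, hnlt⟩ := h4 t' ht'.1 hlt ht'.2.1
      exact absurd ((stays_shift_iff _ _).1 ht'.2.2 n hn) (by omega)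

/-- A nearest neighbour path takes every value that it passes. -/
theorem exists_first_hit (ξ : ℕ → Mark) {m : ℕ} {l : ℤ} (hl : 1 ≤ l) (hm : l ≤ height ξ m) :
    ∃ t, 1 ≤ t ∧ t ≤ m ∧ height ξ t = l ∧ ∀ j < t, height ξ j < l := by
  classical
  have hex : ∃ t, l ≤ height ξ t := ⟨m, hm⟩
  have hlt : ∀ j < Nat.find hex, height ξ j < l := fun j hj => not_le.1 (Nat.find_min hex hj)
  have hpos : 1 ≤ Nat.find hex := by
    by_contra! h0
    have := Nat.find_spec hex
    rw [Nat.lt_one_iff.1 h0, height_zero] at this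
    omega
  refine ⟨Nat.find hex, hpos, Nat.find_min' hex hm, ?_, hlt⟩
  obtain ⟨u, hu⟩ := Nat.exists_eq_add_of_le' hpos
  have h1 := hlt u (by omega)
  have h2 := Nat.find_spec hex
  rw [hu, height_succ] at *
  split_ifs at * <;> omega

/-- A path that goes from `l` to below `l` steps down from `l` in between. -/
theorem exists_step_down (ξ : ℕ → Mark) {t n : ℕ} {l : ℤ} (htn : t ≤ n) (ht : l ≤ height ξ t)
    (hn : height ξ n < l) : ∃ u, u < n ∧ height ξ u = l ∧ (ξ u).1.1 = true := by
  induction n, htn using Nat.le_induction with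
  | base => omega
  | succ n htn ih =>
    by_cases h : height ξ n < l
    · obtain ⟨u, hu, h'⟩ := ih h
      exact ⟨u, by omega, h'⟩
    · rw [height_succ] at hn
      refine ⟨n, by omega, ?_, ?_⟩ <;> split_ifs at hn with h0 <;> first | exact h0 | omega

/-- If no level in `[1, h]` is regenerative, then at least `h` steps back are allowed. -/
theorem le_backs_of_destroyed (ξ : ℕ → Mark) {m h : ℕ}
    (H : ∀ l : ℤ, 1 ≤ l → l ≤ h → ∃ u < m, height ξ u = l ∧ (ξ u).1.1 = true) :
    h ≤ backs ξ m := by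
  have H' : ∀ i : Fin h, ∃ u < m, height ξ u = (i : ℤ) + 1 ∧ (ξ u).1.1 = true := fun i =>
    H _ (by omega) (by omega)
  choose u hu1 hu2 hu3 using H'
  have hinj : Function.Injective u := fun i j hij => by
    have := hu2 i
    rw [hij, hu2 j] at this
    exact Fin.ext (by omega)
  calc h = (Finset.univ.image u).card := by rw [Finset.card_image_of_injective _ hinj]; simp
    _ ≤ _ := Finset.card_le_card fun x hx => by
      obtain ⟨i, -, rfl⟩ := Finset.mem_image.1 hx
      exact Finset.mem_filter.2 ⟨Finset.mem_range.2 (hu1 i), hu3 i⟩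

/-- Every level strictly between zero and the final height is reached by a record that is undercut
within the block, hence is left by a step down. These steps are distinct, so the height at `t`,
which is `t - 2 * backs ξ t`, exceeds `backs ξ t` by at most one. -/
theorem IsBlock.le_backs {ξ : ℕ → Mark} {t : ℕ} (hb : IsBlock ξ t) : t ≤ 3 * backs ξ t + 1 := by
  obtain ⟨h1, h2, h3, h4⟩ := hb
  have hpos := h3 0 (by omega)
  have key : (height ξ t - 1).toNat ≤ backs ξ t := by
    refine le_backs_of_destroyed ξ fun l hl hlh => ?_
    obtain ⟨s, hs1, hst, hsl, hrec⟩ := exists_first_hit ξ (m := t) hl (by omega)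
    have hst' : s < t := lt_of_le_of_ne hst (by rintro rfl; omega)
    obtain ⟨n, hsn, hnt, hlt⟩ := h4 s hs1 hst' (by rwa [hsl])
    obtain ⟨u, hu, hu'⟩ := exists_step_down ξ hsn hsl.ge (hsl ▸ hlt)
    exact ⟨u, by omega, hu'⟩
  have := height_eq ξ t
  rw [height_zero] at hpos
  omega

/-- From time `m` on the height is at least half the time. If no level up to `m / 2` were
regenerative, each would be left by a step down before `m`, which needs more flags than the
hypothesis grants. -/
theorem exists_isRegen {ξ : ℕ → Mark} {m : ℕ} (hm : 4 ≤ m)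
    (h : ∀ n, m ≤ n → 4 * backs ξ n ≤ n) : ∃ t, IsRegen ξ t := by
  by_contra! hcon
  have hY : ∀ n, m ≤ n → (n : ℤ) ≤ 2 * height ξ n := fun n hn => by
    have := height_eq ξ n; have := h n hn; omega
  have key : (m + 1) / 2 ≤ backs ξ m := by
    refine le_backs_of_destroyed ξ fun l hl hlh => ?_
    obtain ⟨s, hs1, hst, hsl, hrec⟩ := exists_first_hit ξ (m := m) hl
      (by have := hY m le_rfl; omega)
    have hns := hcon s
    simp only [IsRegen, not_and] at hns
    have := hns hs1 (by rwa [hsl])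
    rw [stays_shift_iff] at this
    push Not at this
    obtain ⟨n, hsn, hlt⟩ := this
    -- From time `m` on the height is at least `m / 2` rounded up, hence at least `l`.
    have hnm : n < m := by
      by_contra! hnm
      have := hY n hnm
      omega
    obtain ⟨u, hu, hu'⟩ := exists_step_down ξ hsn hsl.ge (hsl ▸ hlt)
    exact ⟨u, by omega, hu'⟩
  have := h m le_rfl
  omega

/-! ### Lookups in the history -/

theorem lookup_mem {h : List (Vertex × ℕ)} {x : Vertex} {k : ℕ} (hk : h.lookup x = some k) :
    (x, k) ∈ h := by
  induction h with
  | nil => simp at hk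
  | cons e h ih =>
    obtain ⟨y, l⟩ := e
    rw [List.lookup_cons] at hk
    by_cases hxy : x = y
    · subst hxy; simp at hk; simp [hk]
    · rw [beq_false_of_ne hxy] at hk
      exact List.mem_cons_of_mem _ (ih hk)

theorem lookup_eq_none {h : List (Vertex × ℕ)} {x : Vertex} (hx : ∀ e ∈ h, e.1 ≠ x) :
    h.lookup x = none := by
  cases hk : h.lookup x with
  | none => rfl
  | some k => exact absurd rfl (hx _ (lookup_mem hk))

theorem lookup_map_append (h : List (Vertex × ℕ)) (x y : Vertex) :
    (h.map fun e => (e.1 ++ x, e.2)).lookup (y ++ x) = h.lookup y := by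
  induction h with
  | nil => rfl
  | cons e h ih =>
    obtain ⟨z, k⟩ := e
    simp only [List.map_cons, List.lookup_cons, ih]
    by_cases hxy : y = z
    · simp [hxy]
    · rw [beq_false_of_ne hxy, beq_false_of_ne fun h => hxy (List.append_cancel_right h)]

theorem lookup_append (h h' : List (Vertex × ℕ)) (x : Vertex) (hx : ∀ e ∈ h', e.1 ≠ x) :
    (h ++ h').lookup x = h.lookup x := by
  induction h with
  | nil => simpa using lookup_eq_none hx
  | cons e h ih =>
    obtain ⟨z, k⟩ := e
    simp only [List.cons_append, List.lookup_cons, ih]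

/-! ### Pathwise properties of the walk: comparison with the height, fresh environment -/

section Walk

variable {β β' : ℝ≥0}

theorem lazyState_succ (ξ : ℕ → Mark) (n : ℕ) :
    lazyState β β' ξ (n + 1) = next β β' (lazyState β β' ξ n) (ξ n) := rfl

theorem degree_mem (s : State) (d : ℕ) : degree s d = max 1 d ∨ ∃ e ∈ s.2, degree s d = e.2 := by
  unfold degree
  cases hk : s.2.lookup s.1 with
  | none => simp
  | some k => exact Or.inr ⟨_, lookup_mem hk, rfl⟩

/-- All the degrees in the history were discovered before. -/
theorem exists_of_mem_history (ξ : ℕ → Mark) (n : ℕ) {e : Vertex × ℕ}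
    (he : e ∈ (lazyState β β' ξ n).2) :
    (∃ j < n, e.1 = (lazyState β β' ξ j).1) ∧ ∃ j < n, e.2 = max 1 (ξ j).2 := by
  induction n generalizing e with
  | zero => simp [lazyState] at he
  | succ n ih =>
    rw [lazyState_succ, next, List.mem_cons] at he
    rcases he with rfl | he
    · refine ⟨⟨n, by omega, rfl⟩, ?_⟩
      rcases degree_mem (lazyState β β' ξ n) (ξ n).2 with h | ⟨e, he, h⟩
      · exact ⟨n, by omega, h⟩
      · obtain ⟨-, j, hj, hje⟩ := ih he
        exact ⟨j, by omega, h.trans hje⟩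
    · obtain ⟨⟨i, hi, hie⟩, j, hj, hje⟩ := ih he
      exact ⟨⟨i, by omega, hie⟩, j, by omega, hje⟩

/-- Summing over all candidates `j` later makes it unnecessary to know which visit discovered the
vertex. -/
theorem exists_degree_eq (ξ : ℕ → Mark) (n : ℕ) :
    ∃ j ≤ n, degree (lazyState β β' ξ n) (ξ n).2 = max 1 (ξ j).2 := by
  rcases degree_mem (lazyState β β' ξ n) (ξ n).2 with h | ⟨e, he, h⟩
  · exact ⟨n, le_rfl, h⟩
  · obtain ⟨-, j, hj, hje⟩ := exists_of_mem_history ξ n he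
    exact ⟨j, hj.le, h.trans hje⟩

/-- This is the purpose of `max 1 d`: vertices have a child for every noise, so the pathwise
arguments need no exceptional null set. -/
theorem degree_ne_zero (ξ : ℕ → Mark) (n : ℕ) :
    degree (lazyState β β' ξ n) (ξ n).2 ≠ 0 := by
  obtain ⟨j, -, hj⟩ := exists_degree_eq (β := β) (β' := β') ξ n
  omega

theorem length_move_of_not_back {k : ℕ} (hk : k ≠ 0) {m : Move} (hm : m.1 = false) (x : Vertex) :
    (move β β' k m x).length = x.length + 1 := by
  cases x <;> simp [move, hk, hm]

theorem length_move_le (k : ℕ) (m : Move) (x : Vertex) :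
    (move β β' k m x).length ≤ x.length + 1 := by
  cases x <;> simp only [move] <;> split_ifs <;>
    simp only [List.length_cons, List.length_nil] <;> omega

theorem le_length_move (k : ℕ) (m : Move) (x : Vertex) :
    x.length ≤ (move β β' k m x).length + 1 := by
  cases x <;> simp only [move] <;> split_ifs <;> simp

theorem depth_succ_of_not_back (ξ : ℕ → Mark) {n : ℕ} (h : (ξ n).1.1 = false) :
    depth β β' ξ (n + 1) = depth β β' ξ n + 1 :=
  length_move_of_not_back (degree_ne_zero ξ n) h _

theorem depth_succ_le (ξ : ℕ → Mark) (n : ℕ) : depth β β' ξ (n + 1) ≤ depth β β' ξ n + 1 :=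
  length_move_le _ _ _

theorem le_depth_succ (ξ : ℕ → Mark) (n : ℕ) : depth β β' ξ n ≤ depth β β' ξ (n + 1) + 1 :=
  le_length_move _ _ _

theorem depth_le (ξ : ℕ → Mark) (n : ℕ) : depth β β' ξ n ≤ n := by
  induction n with
  | zero => rfl
  | succ n ih => exact (depth_succ_le ξ n).trans (by omega)

/-- Without a flag both quantities rise by one; with a flag the height falls by one and the depth by
at most one. -/
theorem height_sub_le_depth_sub (ξ : ℕ → Mark) {j n : ℕ} (hj : j ≤ n) :
    height ξ n - height ξ j ≤ (depth β β' ξ n : ℤ) - depth β β' ξ j := by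
  induction n, hj using Nat.le_induction with
  | base => simp
  | succ n _ ih =>
    have h1 := le_depth_succ (β := β) (β' := β') ξ n
    rw [height_succ]
    cases hb : (ξ n).1.1
    · rw [depth_succ_of_not_back ξ hb]; simp; omega
    · simp; omega

theorem height_le_depth (ξ : ℕ → Mark) (n : ℕ) : height ξ n ≤ depth β β' ξ n := by
  have := height_sub_le_depth_sub (β := β) (β' := β') ξ (Nat.zero_le n)
  simpa [depth, lazyState] using this

/-- After a record of the height that is never undercut, the walk is in fresh environment. -/
theorem lazyState_add_of_fresh {ξ : ℕ → Mark} {t : ℕ}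
    (hrec : ∀ j < t, height ξ j < height ξ t) (hs : Stays (shift t ξ)) (m : ℕ) :
    lazyState β β' ξ (t + m) =
      ((lazyState β β' (shift t ξ) m).1 ++ (lazyState β β' ξ t).1,
        ((lazyState β β' (shift t ξ) m).2.map fun e => (e.1 ++ (lazyState β β' ξ t).1, e.2)) ++
          (lazyState β β' ξ t).2) := by
  -- Earlier vertices are strictly closer to the root than the vertex at time `t`, so none of them
  -- lies in its subtree.
  have hfresh : ∀ e ∈ (lazyState β β' ξ t).2, ∀ y : Vertex,
      e.1 ≠ y ++ (lazyState β β' ξ t).1 := by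
    intro e he y hy
    obtain ⟨⟨j, hj, hje⟩, -⟩ := exists_of_mem_history ξ t he
    have h1 := height_sub_le_depth_sub (β := β) (β' := β') ξ hj.le
    have h2 := hrec j hj
    have h3 : depth β β' ξ j = y.length + depth β β' ξ t := by
      unfold depth; rw [← hje, hy, List.length_append]
    omega
  induction m with
  | zero => simp [lazyState]
  | succ m ih =>
    have hdeg : degree (lazyState β β' ξ (t + m)) (ξ (t + m)).2 =
        degree (lazyState β β' (shift t ξ) m) (shift t ξ m).2 := by
      unfold degree
      rw [ih]
      simp only
      rw [lookup_append _ _ _ (fun e he => hfresh e he _), lookup_map_append]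
      rfl
    have hk := degree_ne_zero (β := β) (β' := β') (shift t ξ) m
    have hmove : move β β' (degree (lazyState β β' (shift t ξ) m) (shift t ξ m).2)
        (shift t ξ m).1 ((lazyState β β' (shift t ξ) m).1 ++ (lazyState β β' ξ t).1) =
        move β β' (degree (lazyState β β' (shift t ξ) m) (shift t ξ m).2)
          (shift t ξ m).1 (lazyState β β' (shift t ξ) m).1 ++ (lazyState β β' ξ t).1 := by
      generalize degree (lazyState β β' (shift t ξ) m) (shift t ξ m).2 = k at hk
      cases hy : (lazyState β β' (shift t ξ) m).1 with
      | cons a y =>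
        simp only [List.cons_append, move]
        split_ifs <;> rfl
      -- The shifted walk is at its root, where its step rule differs from that at an inner vertex.
      -- Its height is at most zero there, so staying nonnegative forbids a flag, and both rules
      -- then select the same child.
      | nil =>
        have h0 : height (shift t ξ) m ≤ 0 := by
          have := height_le_depth (β := β) (β' := β') (shift t ξ) m
          simpa [depth, hy] using this
        have hb : (shift t ξ m).1.1 = false := by
          have := hs (m + 1)
          rw [height_succ] at this
          by_contra hb
          rw [Bool.not_eq_false] at hb
          rw [hb] at this
          simp at this
          omega
        cases (lazyState β β' ξ t).1 <;> simp [move, hk, hb]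
    rw [← add_assoc, lazyState_succ, lazyState_succ]
    simp only [next, hdeg]
    rw [ih]
    simp only [List.map_cons, List.cons_append]
    rw [← hmove]
    rfl

theorem depth_add_of_fresh {ξ : ℕ → Mark} {t : ℕ}
    (hrec : ∀ j < t, height ξ j < height ξ t) (hs : Stays (shift t ξ)) (m : ℕ) :
    depth β β' ξ (t + m) = depth β β' ξ t + depth β β' (shift t ξ) m := by
  simp only [depth, lazyState_add_of_fresh hrec hs m, List.length_append, add_comm]

theorem lazyState_congr {ξ ξ' : ℕ → Mark} {n : ℕ} (h : ∀ i < n, ξ i = ξ' i) :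
    lazyState β β' ξ n = lazyState β β' ξ' n := by
  induction n with
  | zero => rfl
  | succ n ih =>
    rw [lazyState_succ, lazyState_succ, h n (by omega), ih fun i hi => h i (by omega)]

theorem depth_congr {ξ ξ' : ℕ → Mark} {n : ℕ} (h : ∀ i < n, ξ i = ξ' i) :
    depth β β' ξ n = depth β β' ξ' n := by
  unfold depth; rw [lazyState_congr h]

end Walk

/-! ### The law of the noise -/

/-- The law of the flag which allows a step back. -/
def flagLaw (β : ℝ≥0) : Measure Bool :=
  ((1 / (1 + β) : ℝ≥0) : ℝ≥0∞) • Measure.dirac true +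
    ((β / (1 + β) : ℝ≥0) : ℝ≥0∞) • Measure.dirac false

instance (β : ℝ≥0) : IsProbabilityMeasure (flagLaw β) := by
  constructor
  have h : 1 / (1 + β) + β / (1 + β) = 1 := by field_simp
  simp only [flagLaw, Measure.coe_add, Pi.add_apply, Measure.smul_apply, measure_univ, smul_eq_mul,
    mul_one]
  exact_mod_cast h

/-- The uniform law on the unit interval. -/
def unitLaw : Measure ℝ := volume.restrict (Set.Ico 0 1)

instance : IsProbabilityMeasure unitLaw := ⟨by simp [unitLaw]⟩

/-- The law of the randomness of one step. -/
def moveLaw (β : ℝ≥0) : Measure Move := (flagLaw β).prod (unitLaw.prod unitLaw)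

instance (β : ℝ≥0) : IsProbabilityMeasure (moveLaw β) := by unfold moveLaw; infer_instance

/-- The law of a mark. -/
def markLaw (p : PMF ℕ) (β : ℝ≥0) : Measure Mark := (moveLaw β).prod p.toMeasure

instance (p : PMF ℕ) (β : ℝ≥0) : IsProbabilityMeasure (markLaw p β) := by
  unfold markLaw; infer_instance

/-- The law of a sequence of independent marks. -/
def noiseLaw (p : PMF ℕ) (β : ℝ≥0) : Measure (ℕ → Mark) :=
  Measure.infinitePi fun _ => markLaw p β

instance (p : PMF ℕ) (β : ℝ≥0) : IsProbabilityMeasure (noiseLaw p β) := by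
  unfold noiseLaw; infer_instance

/-- The event or function depends only on the first `t` marks. -/
def DependsOnPast {α : Type*} (t : ℕ) (f : (ℕ → Mark) → α) : Prop :=
  ∀ ξ ξ', (∀ i < t, ξ i = ξ' i) → f ξ = f ξ'

/-! ### Measurability -/

section Measurability

variable {β β' : ℝ≥0}

theorem measurable_move (k : ℕ) (x : Vertex) : Measurable fun m : Move => move β β' k m x := by
  have hfl : Measurable fun m : Move => ⌊m.2.2 * k⌋₊ :=
    Nat.measurable_floor.comp (measurable_snd.snd.mul_const _)
  cases x with
  | nil =>
    simp only [move]
    split_ifs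
    · exact measurable_const
    · exact (measurable_of_countable fun i : ℕ => ([i] : Vertex)).comp hfl
  | cons a y =>
    simp only [move]
    refine Measurable.ite ?_ measurable_const
      ((measurable_of_countable fun i : ℕ => (i :: a :: y : Vertex)).comp hfl)
    refine (MeasurableSet.const _).union (MeasurableSet.inter ?_ ?_)
    · exact measurable_fst (measurableSet_singleton true)
    · exact measurableSet_lt measurable_snd.fst measurable_const

theorem measurable_next : Measurable fun z : State × Mark => next β β' z.1 z.2 := by
  refine measurable_from_prod_countable_right fun s => ?_
  refine measurable_from_prod_countable_left fun d => ?_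
  exact (measurable_move (degree s d) s.1).prodMk
    (measurable_const (a := (s.1, degree s d) :: s.2))

theorem measurable_lazyState (n : ℕ) : Measurable fun ξ => lazyState β β' ξ n := by
  induction n with
  | zero => exact measurable_const
  | succ n ih => exact measurable_next.comp (ih.prodMk (measurable_pi_apply n))

theorem measurable_depth (n : ℕ) : Measurable fun ξ => depth β β' ξ n :=
  (measurable_of_countable fun s : State => s.1.length).comp (measurable_lazyState n)

theorem measurable_back (i : ℕ) : Measurable fun ξ : ℕ → Mark => (ξ i).1.1 :=
  (measurable_pi_apply i).fst.fst

theorem measurable_height (n : ℕ) : Measurable fun ξ => height ξ n :=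
  Finset.measurable_sum _ fun i _ =>
    (measurable_of_countable fun b : Bool => if b then (-1 : ℤ) else 1).comp (measurable_back i)

theorem measurable_backs (n : ℕ) : Measurable fun ξ => backs ξ n := by
  induction n with
  | zero => exact measurable_const
  | succ n ih =>
    simp only [backs_succ]
    exact ih.add ((measurable_of_countable fun b : Bool => if b then 1 else 0).comp
      (measurable_back n))

theorem measurable_shift (t : ℕ) : Measurable (shift t) :=
  measurable_pi_lambda _ fun _ => measurable_pi_apply _

theorem measurableSet_stays : MeasurableSet {ξ | Stays ξ} := by
  simp only [Stays, Set.ofPred_forall]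
  exact MeasurableSet.iInter fun n => measurableSet_le measurable_const (measurable_height n)

theorem measurableSet_record (t : ℕ) : MeasurableSet {ξ | ∀ j < t, height ξ j < height ξ t} := by
  simp only [Set.ofPred_forall]
  exact MeasurableSet.iInter fun j => MeasurableSet.iInter fun _ =>
    measurableSet_lt (measurable_height j) (measurable_height t)

theorem measurableSet_isRegen (t : ℕ) : MeasurableSet {ξ | IsRegen ξ t} :=
  (MeasurableSet.const _).inter
    ((measurableSet_record t).inter (measurable_shift t measurableSet_stays))

theorem measurableSet_isBlock (t : ℕ) : MeasurableSet {ξ | IsBlock ξ t} := by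
  have h1 : MeasurableSet {ξ | ∀ j ≤ t, 0 ≤ height ξ j} := by
    simp only [Set.ofPred_forall]
    exact MeasurableSet.iInter fun j => MeasurableSet.iInter fun _ =>
      measurableSet_le measurable_const (measurable_height j)
  have h2 : MeasurableSet {ξ | ∀ t', 1 ≤ t' → t' < t → (∀ j < t', height ξ j < height ξ t') →
      ∃ n, t' ≤ n ∧ n ≤ t ∧ height ξ n < height ξ t'} := by
    simp only [Set.ofPred_forall]
    refine MeasurableSet.iInter fun t' => MeasurableSet.iInter fun _ => MeasurableSet.iInter
      fun _ => ?_
    have h3 : MeasurableSet {ξ | ∃ n, t' ≤ n ∧ n ≤ t ∧ height ξ n < height ξ t'} := by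
      simp only [Set.ofPred_exists]
      exact MeasurableSet.iUnion fun n => (MeasurableSet.const _).inter
        ((MeasurableSet.const _).inter
          (measurableSet_lt (measurable_height n) (measurable_height t')))
    exact MeasurableSet.imp (measurableSet_record t') h3
  exact (MeasurableSet.const _).inter (h1.inter ((measurableSet_record t).inter h2))

/-- The value `0` is the infimum of the empty set: time `0` is never a regeneration, so it needs a
case of its own. -/
theorem measurable_regenTime : Measurable regenTime := by
  classical
  refine measurable_to_countable' fun t => ?_
  rcases Nat.eq_zero_or_pos t with rfl | ht
  · have : regenTime ⁻¹' {0} = ⋂ t, {ξ | IsRegen ξ t}ᶜ := by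
      ext ξ
      simp only [Set.mem_preimage, Set.mem_singleton_iff, regenTime, Nat.sInf_eq_zero,
        Set.mem_iInter, Set.mem_compl_iff, Set.mem_ofPred_eq, Set.eq_empty_iff_forall_notMem]
      refine ⟨?_, Or.inr⟩
      rintro (h | h)
      · exact absurd h.1 (by omega)
      · exact h
    rw [this]
    exact MeasurableSet.iInter fun t => (measurableSet_isRegen t).compl
  · have : regenTime ⁻¹' {t} = {ξ | IsRegen ξ t} ∩ ⋂ s : Fin t, {ξ | IsRegen ξ s}ᶜ := by
      ext ξ
      simp only [Set.mem_preimage, Set.mem_singleton_iff, regenTime, Set.mem_inter_iff,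
        Set.mem_iInter, Set.mem_compl_iff, Set.mem_ofPred_eq]
      constructor
      · rintro rfl
        exact ⟨Nat.sInf_mem (Nat.nonempty_of_pos_sInf ht), fun s => Nat.notMem_of_lt_sInf s.2⟩
      · rintro ⟨h1, h2⟩
        refine le_antisymm (Nat.sInf_le h1) (le_csInf ⟨t, h1⟩ fun s hs => ?_)
        by_contra! hlt
        exact h2 ⟨s, hlt⟩ hs
    rw [this]
    exact (measurableSet_isRegen t).inter
      (MeasurableSet.iInter fun s => (measurableSet_isRegen _).compl)

end Measurability

/-! ### Independence of past and future marks -/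

section Noise

variable (p : PMF ℕ) (β : ℝ≥0)

theorem measurePreserving_shift (t : ℕ) :
    MeasurePreserving (shift t) (noiseLaw p β) (noiseLaw p β) :=
  ⟨measurable_shift t, Measure.map_infinitePi_infinitePi_of_inj (f := fun n => t + n)
    (P := fun _ => markLaw p β) (fun a b h => by simpa using h)⟩

theorem iIndepFun_noise : iIndepFun (fun i (ξ : ℕ → Mark) => ξ i) (noiseLaw p β) :=
  iIndepFun_infinitePi (X := fun _ x => x) fun _ => measurable_id

/-- The marks after time `t` are independent of the marks before. -/
theorem noiseLaw_inter_shift {t : ℕ} {A B : Set (ℕ → Mark)} (hA : MeasurableSet A)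
    (hAt : DependsOnPast t (· ∈ A)) (hB : MeasurableSet B) :
    noiseLaw p β (A ∩ shift t ⁻¹' B) = noiseLaw p β A * noiseLaw p β B := by
  let m : ℕ → MeasurableSpace (ℕ → Mark) := fun i =>
    MeasurableSpace.comap (fun ξ => ξ i) inferInstance
  have hind : Indep (⨆ i ∈ Set.Iio t, m i) (⨆ i ∈ Set.Ici t, m i) (noiseLaw p β) :=
    indep_iSup_of_disjoint (fun i => (measurable_pi_apply i).comap_le)
      ((iIndepFun_iff_iIndep _ _ _).1 (iIndepFun_noise p β))
      (Set.disjoint_left.2 fun i h1 h2 => (not_lt.2 (Set.mem_Ici.1 h2)) (Set.mem_Iio.1 h1))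
  have hm : ∀ (S : Set ℕ) (i : ℕ), i ∈ S →
      Measurable[⨆ i ∈ S, m i] fun ξ : ℕ → Mark => ξ i := fun S i hi =>
    (comap_measurable _).mono (le_iSup₂_of_le i hi le_rfl) le_rfl
  -- Overwriting the marks from time `t` on does not affect membership in `A`, which places `A` in
  -- the past sigma-algebra.
  let pad : (ℕ → Mark) → ℕ → Mark := fun ξ n => if n < t then ξ n else default
  have hpad : Measurable[⨆ i ∈ Set.Iio t, m i] pad := by
    refine @measurable_pi_lambda _ _ _ (_) _ _ fun n => ?_
    by_cases hn : n < t
    · simpa only [pad, hn, if_true] using hm (Set.Iio t) n hn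
    · simpa only [pad, hn, if_false] using @measurable_const _ _ _ (_) _
  have hsh : Measurable[⨆ i ∈ Set.Ici t, m i] (shift t) :=
    @measurable_pi_lambda _ _ _ (_) _ _ fun n => hm (Set.Ici t) (t + n) (Nat.le_add_right t n)
  have hA' : A = pad ⁻¹' A := by
    ext ξ
    exact iff_of_eq (hAt _ _ fun i hi => by simp [pad, hi])
  rw [← (measurePreserving_shift p β t).measure_preimage hB.nullMeasurableSet]
  rw [hA']
  exact (Indep_iff _ _ _).1 hind _ _ (hpad hA) (hsh hB)

end Noise

/-! ### Exponential moments of the number of flags, existence of regenerations -/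

section Backs

variable (p : PMF ℕ) (β : ℝ≥0)

theorem flagLaw_true : flagLaw β {true} = ((1 / (1 + β) : ℝ≥0) : ℝ≥0∞) := by
  simp [flagLaw]

theorem lintegral_flagLaw (f : Bool → ℝ≥0∞) :
    ∫⁻ b, f b ∂flagLaw β = ((1 / (1 + β) : ℝ≥0) : ℝ≥0∞) * f true +
      ((β / (1 + β) : ℝ≥0) : ℝ≥0∞) * f false := by
  rw [flagLaw, lintegral_add_measure, lintegral_smul_measure, lintegral_smul_measure,
    lintegral_dirac, lintegral_dirac]
  rfl

theorem map_flag_noiseLaw (i : ℕ) :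
    (noiseLaw p β).map (fun ξ => (ξ i).1.1) = flagLaw β := by
  have h1 : MeasurePreserving (fun ξ : ℕ → Mark => ξ i) (noiseLaw p β) (markLaw p β) :=
    measurePreserving_eval_infinitePi (fun _ => markLaw p β) i
  have h2 : MeasurePreserving (Prod.fst : Mark → Move) (markLaw p β) (moveLaw β) :=
    measurePreserving_fst
  have h3 : MeasurePreserving (Prod.fst : Move → Bool) (moveLaw β) (flagLaw β) :=
    measurePreserving_fst
  exact ((h3.comp h2).comp h1).map_eq

theorem lintegral_prod_noiseLaw (ψ : ℕ → Mark → ℝ≥0∞) (hψ : ∀ i, Measurable (ψ i)) (t : ℕ) :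
    ∫⁻ ξ, ∏ i ∈ Finset.range t, ψ i (ξ i) ∂noiseLaw p β =
      ∏ i ∈ Finset.range t, ∫⁻ m, ψ i m ∂markLaw p β := by
  refine (lintegral_prod_eq_prod_lintegral_of_indepFun (μ := noiseLaw p β) (Finset.range t)
    (fun i (ξ : ℕ → Mark) => ψ i (ξ i)) (iIndepFun_infinitePi (X := fun i x => ψ i x) hψ)
    fun i => (hψ i).comp (measurable_pi_apply i)).trans ?_
  refine Finset.prod_congr rfl fun i _ => ?_
  exact (measurePreserving_eval_infinitePi (fun _ => markLaw p β) i).lintegral_comp (hψ i)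

/-- The weight of a flag in exponential moments of `backs`. -/
def backWeight (b : Bool) : ℝ≥0∞ := if b then (((1 + β) / 2 : ℝ≥0) : ℝ≥0∞) else 1

theorem prod_backWeight (ξ : ℕ → Mark) (t : ℕ) :
    ∏ i ∈ Finset.range t, backWeight β (ξ i).1.1 =
      (((1 + β) / 2 : ℝ≥0) : ℝ≥0∞) ^ backs ξ t := by
  induction t with
  | zero => simp
  | succ t ih =>
    rw [Finset.prod_range_succ, ih, backs_succ, backWeight]
    split_ifs <;> simp [pow_succ]

/-- The weight `(1 + β) / 2` makes a flag contribute exactly `1 / 2`, so the bound is uniform in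
`β`. -/
theorem lintegral_backWeight_le :
    ∫⁻ b, backWeight β b ∂flagLaw β ≤ ((3 / 2 : ℝ≥0) : ℝ≥0∞) := by
  rw [lintegral_flagLaw]
  simp only [backWeight, if_true, Bool.false_eq_true, if_false, mul_one]
  rw [← ENNReal.coe_mul, ← ENNReal.coe_add, ENNReal.coe_le_coe]
  have h1 : β / (1 + β) ≤ 1 := div_le_one_of_le₀ (by simp) (by positivity)
  have h2 : 1 / (1 + β) * ((1 + β) / 2) = 1 / 2 := by field_simp
  rw [h2]
  calc (1 / 2 : ℝ≥0) + β / (1 + β) ≤ 1 / 2 + 1 := by gcongr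
    _ = 3 / 2 := by norm_num

theorem lintegral_markLaw_flag (f : Bool → ℝ≥0∞) :
    ∫⁻ m, f m.1.1 ∂markLaw p β = ∫⁻ b, f b ∂flagLaw β := by
  have h2 : MeasurePreserving (Prod.fst : Mark → Move) (markLaw p β) (moveLaw β) :=
    measurePreserving_fst
  have h3 : MeasurePreserving (Prod.fst : Move → Bool) (moveLaw β) (flagLaw β) :=
    measurePreserving_fst
  exact (h3.comp h2).lintegral_comp (measurable_of_countable f)

variable {β}

/-- Markov's inequality for the exponential moment of `backs`. -/
theorem indicator_le_backs (hβ : 717 ≤ β) (ξ : ℕ → Mark) {M t : ℕ} (hM : M ≤ backs ξ t) :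
    1 ≤ (((2 / (1 + β) : ℝ≥0) : ℝ≥0∞) ^ M) * ∏ i ∈ Finset.range t, backWeight β (ξ i).1.1 := by
  rw [prod_backWeight, ← ENNReal.coe_pow, ← ENNReal.coe_pow, ← ENNReal.coe_mul]
  norm_cast
  have hr : (1 : ℝ≥0) ≤ (1 + β) / 2 := by
    rw [le_div_iff₀ (by norm_num), one_mul]
    calc (2 : ℝ≥0) ≤ 717 := by norm_num
      _ ≤ β := hβ
      _ ≤ 1 + β := by simp
  calc (1 : ℝ≥0) = (2 / (1 + β)) ^ M * ((1 + β) / 2) ^ M := by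
        rw [← mul_pow, show 2 / (1 + β) * ((1 + β) / 2) = 1 by field_simp, one_pow]
    _ ≤ _ := by gcongr

theorem noiseLaw_le_backs (hβ : 717 ≤ β) (M t : ℕ) :
    noiseLaw p β {ξ | M ≤ backs ξ t} ≤
      ((2 / (1 + β) : ℝ≥0) : ℝ≥0∞) ^ M * ((3 / 2 : ℝ≥0) : ℝ≥0∞) ^ t := by
  have hm : MeasurableSet {ξ | M ≤ backs ξ t} :=
    measurableSet_le measurable_const (measurable_backs t)
  calc noiseLaw p β {ξ | M ≤ backs ξ t}
      = ∫⁻ ξ, {ξ | M ≤ backs ξ t}.indicator 1 ξ ∂noiseLaw p β := (lintegral_indicator_one hm).symm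
    _ ≤ ∫⁻ ξ, ((2 / (1 + β) : ℝ≥0) : ℝ≥0∞) ^ M *
          ∏ i ∈ Finset.range t, backWeight β (ξ i).1.1 ∂noiseLaw p β := by
        refine lintegral_mono fun ξ => ?_
        by_cases hξ : M ≤ backs ξ t
        · simpa [Set.indicator, hξ] using indicator_le_backs hβ ξ hξ
        · simp [Set.indicator, hξ]
    _ = ((2 / (1 + β) : ℝ≥0) : ℝ≥0∞) ^ M *
          ∏ i ∈ Finset.range t, ∫⁻ b, backWeight β b ∂flagLaw β := by
        rw [lintegral_const_mul' _ _ (by finiteness), lintegral_prod_noiseLaw p β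
          (fun _ m => backWeight β m.1.1)
          (fun _ => (measurable_of_countable (backWeight β)).comp measurable_fst.fst)]
        simp_rw [lintegral_markLaw_flag]
    _ ≤ _ := by
        rw [Finset.prod_const, Finset.card_range]
        gcongr
        exact lintegral_backWeight_le β

/-- For `β ≥ 717` the left side is at most `1 / 359`, and `7 ^ 3 = 343`. A cube is convenient
because the number of flags in a block is about a third of its length. -/
theorem two_div_le (hβ : 717 ≤ β) : 2 / (1 + β) ≤ (1 / 7) ^ 3 := by
  rw [div_le_iff₀ (by positivity)]
  have : (717 : ℝ) ≤ β := by exact_mod_cast hβ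
  rw [← NNReal.coe_le_coe]
  push_cast
  linarith

/-- Long blocks need many flags. The ratio is `(1 / 7) * (3 / 2)`, and the factor `7` pays for the
rounding in `(t + 1) / 3`. -/
theorem noiseLaw_isBlock_le (hβ : 717 ≤ β) (t : ℕ) :
    noiseLaw p β {ξ | IsBlock ξ t} ≤ ((7 * (3 / 14) ^ t : ℝ≥0) : ℝ≥0∞) := by
  calc noiseLaw p β {ξ | IsBlock ξ t} ≤ noiseLaw p β {ξ | (t + 1) / 3 ≤ backs ξ t} :=
        measure_mono fun ξ hξ => by
          have := IsBlock.le_backs (ξ := ξ) hξ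
          show (t + 1) / 3 ≤ backs ξ t
          omega
    _ ≤ _ := noiseLaw_le_backs p hβ _ _
    _ ≤ _ := by
        norm_cast
        calc (2 / (1 + β)) ^ ((t + 1) / 3) * (3 / 2 : ℝ≥0) ^ t
            ≤ ((1 / 7) ^ 3) ^ ((t + 1) / 3) * (3 / 2 : ℝ≥0) ^ t := by
              gcongr; exact two_div_le hβ
          _ = 7 * ((1 / 7) ^ (3 * ((t + 1) / 3) + 1) * (3 / 2 : ℝ≥0) ^ t) := by
              rw [pow_succ (1 / 7 : ℝ≥0) (3 * ((t + 1) / 3)), pow_mul]; field_simp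
          _ ≤ 7 * ((1 / 7) ^ t * (3 / 2 : ℝ≥0) ^ t) := by
              refine mul_le_mul_right (mul_le_mul_left
                (pow_le_pow_of_le_one (by norm_num) ?_ (by omega)) _) _
              rw [div_le_one (by norm_num)]; norm_num
          _ = 7 * (3 / 14) ^ t := by rw [← mul_pow]; norm_num

theorem tendsto_backs_div :
    ∀ᵐ ξ ∂noiseLaw p β, Tendsto (fun n : ℕ => (backs ξ n : ℝ) / n) atTop
      (𝓝 ((flagLaw β).real {true})) := by
  let g : Bool → ℝ := fun b => if b then 1 else 0
  have hg : Measurable g := measurable_of_countable g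
  have hX : ∀ i, Measurable fun ξ : ℕ → Mark => g (ξ i).1.1 := fun i => hg.comp (measurable_back i)
  have hlaw : ∀ i, (noiseLaw p β).map (fun ξ => g (ξ i).1.1) = (flagLaw β).map g := fun i => by
    rw [← map_flag_noiseLaw p β i, Measure.map_map hg (measurable_back i)]; rfl
  have h := strong_law_ae_real (μ := noiseLaw p β) (fun i ξ => g (ξ i).1.1)
    (Integrable.of_bound (hX 0).aestronglyMeasurable 1 (ae_of_all _ fun ξ => by
      simp only [g]; split_ifs <;> simp))
    (fun i j hij => ((iIndepFun_noise p β).indepFun hij).comp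
      (hg.comp measurable_fst.fst) (hg.comp measurable_fst.fst))
    (fun i => ⟨(hX i).aemeasurable, (hX 0).aemeasurable, by rw [hlaw, hlaw]⟩)
  have hmean : ∫ ξ, g (ξ 0).1.1 ∂noiseLaw p β = (flagLaw β).real {true} := by
    rw [← integral_indicator_one (measurableSet_singleton true), ← map_flag_noiseLaw p β 0,
      integral_map (measurable_back 0).aemeasurable
        ((measurable_one.indicator (measurableSet_singleton true)).aestronglyMeasurable)]
    refine integral_congr_ae (ae_of_all _ fun ξ => ?_)
    simp [g, Set.indicator]
  rw [hmean] at h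
  filter_upwards [h] with ξ hξ
  refine hξ.congr fun n => ?_
  congr 1
  simp [g, backs]

/-- The density of flags is `1 / (1 + β) < 1 / 4`, so the law of large numbers verifies the
hypothesis of `exists_isRegen`. -/
theorem ae_exists_isRegen (hβ : 717 ≤ β) : ∀ᵐ ξ ∂noiseLaw p β, ∃ t, IsRegen ξ t := by
  filter_upwards [tendsto_backs_div p (β := β)] with ξ hξ
  have hq : (flagLaw β).real {true} < 1 / 4 := by
    rw [measureReal_def, flagLaw_true, ENNReal.coe_toReal, NNReal.coe_div]
    have : (717 : ℝ) ≤ β := by exact_mod_cast hβ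
    push_cast
    rw [div_lt_div_iff₀ (by linarith) (by norm_num)]
    linarith
  have hev := (hξ.eventually (gt_mem_nhds hq)).and (eventually_ge_atTop 4)
  obtain ⟨m, hm⟩ := eventually_atTop.1 hev
  refine exists_isRegen (m := m + 4) (by omega) fun n hn => ?_
  obtain ⟨h1, h2⟩ := hm n (by omega)
  have hn0 : (0 : ℝ) < n := by exact_mod_cast (by omega : 0 < n)
  rw [div_lt_div_iff₀ hn0 (by norm_num)] at h1
  have : (4 * backs ξ n : ℝ) < n := by linarith
  exact_mod_cast this.le

/-- After a regeneration the shifted noise stays nonnegative. If this were a null event it would be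
null for all shifts, contradicting the existence of a regeneration. -/
theorem noiseLaw_stays_ne_zero (hβ : 717 ≤ β) : noiseLaw p β {ξ | Stays ξ} ≠ 0 := by
  intro h0
  have h : ∀ t, ∀ᵐ ξ ∂noiseLaw p β, ¬ Stays (shift t ξ) := fun t => by
    have := (measurePreserving_shift p β t).measure_preimage measurableSet_stays.nullMeasurableSet
    rw [h0] at this
    exact measure_eq_zero_iff_ae_notMem.1 this
  obtain ⟨ξ, ⟨t, ht⟩, h2⟩ := ((ae_exists_isRegen p hβ).and (ae_all_iff.2 h)).exists
  exact h2 t ht.2.2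

end Backs

/-! ### Independent blocks under the conditioned law -/

section Renewal

variable (p : PMF ℕ) {β : ℝ≥0}

/-- The noise after the first regeneration. -/
def renew (ξ : ℕ → Mark) : ℕ → Mark := shift (regenTime ξ) ξ

/-- The law of the noise, given that the height never becomes negative. -/
def stayLaw (p : PMF ℕ) (β : ℝ≥0) : Measure (ℕ → Mark) := (noiseLaw p β)[|{ξ | Stays ξ}]

/-- The value of a process at the first regeneration time. -/
def atRegen {α : Type*} (f : ℕ → (ℕ → Mark) → α) (ξ : ℕ → Mark) : α := f (regenTime ξ) ξ

theorem isProbabilityMeasure_stayLaw (hβ : 717 ≤ β) : IsProbabilityMeasure (stayLaw p β) :=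
  cond_isProbabilityMeasure (noiseLaw_stays_ne_zero p hβ)

theorem measurable_atRegen {α : Type*} [MeasurableSpace α] {f : ℕ → (ℕ → Mark) → α}
    (hf : ∀ t, Measurable (f t)) : Measurable (atRegen f) :=
  (measurable_from_prod_countable_right (f := fun z : ℕ × (ℕ → Mark) => f z.1 z.2) hf).comp
    (measurable_regenTime.prodMk measurable_id)

theorem measurable_renew : Measurable renew :=
  measurable_atRegen (f := shift) measurable_shift

theorem dependsOnPast_isBlock (t : ℕ) : DependsOnPast t (IsBlock · t) := fun _ _ h =>
  propext ⟨IsBlock.congr h, IsBlock.congr fun i hi => (h i hi).symm⟩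

theorem pairwise_disjoint_block :
    Pairwise (Function.onFun Disjoint fun t => {ξ | IsBlock ξ t ∧ Stays (shift t ξ)}) := by
  intro s t hst
  refine Set.disjoint_left.2 fun ξ h1 h2 => hst ?_
  rw [← ((stays_and_regenTime_eq_iff ξ).2 h1).2.2, ((stays_and_regenTime_eq_iff ξ).2 h2).2.2]

/-- The block up to the first regeneration is independent of the noise after it. -/
theorem noiseLaw_stays_inter (hβ : 717 ≤ β) {α : Type*} [MeasurableSpace α]
    {f : ℕ → (ℕ → Mark) → α} (hf : ∀ t, Measurable (f t)) (hft : ∀ t, DependsOnPast t (f t))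
    {B : Set α} (hB : MeasurableSet B) {A : Set (ℕ → Mark)} (hA : MeasurableSet A) :
    noiseLaw p β ({ξ | Stays ξ} ∩ (atRegen f ⁻¹' B ∩ renew ⁻¹' A)) =
      (∑' t, noiseLaw p β ({ξ | IsBlock ξ t} ∩ f t ⁻¹' B)) *
        noiseLaw p β ({ξ | Stays ξ} ∩ A) := by
  -- Split according to the value `t` of the regeneration time. Each piece is an event of the first
  -- `t` marks intersected with an event of the later ones.
  have hE : ({ξ | Stays ξ} ∩ (atRegen f ⁻¹' B ∩ renew ⁻¹' A) : Set (ℕ → Mark))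
      =ᵐ[noiseLaw p β]
      ⋃ t, ({ξ | IsBlock ξ t} ∩ f t ⁻¹' B) ∩ shift t ⁻¹' ({ξ | Stays ξ} ∩ A) := by
    filter_upwards [ae_exists_isRegen p hβ] with ξ hξ
    refine propext ⟨fun hs => ?_, fun hs => ?_⟩
    · obtain ⟨h1, h2⟩ := (stays_and_regenTime_eq_iff ξ).1 ⟨hs.1, hξ, rfl⟩
      exact Set.mem_iUnion.2 ⟨regenTime ξ, ⟨h1, hs.2.1⟩, h2, hs.2.2⟩
    · obtain ⟨t, ⟨h1, hB'⟩, h2, hA'⟩ := Set.mem_iUnion.1 hs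
      obtain ⟨h3, -, rfl⟩ := (stays_and_regenTime_eq_iff ξ).2 ⟨h1, h2⟩
      exact ⟨h3, hB', hA'⟩
  rw [measure_congr hE, measure_iUnion, ← ENNReal.tsum_mul_right]
  · refine tsum_congr fun t => noiseLaw_inter_shift p β
      ((measurableSet_isBlock t).inter (hf t hB)) (fun ξ ξ' h => ?_)
      (measurableSet_stays.inter hA)
    exact congrArg₂ And (dependsOnPast_isBlock t ξ ξ' h) (congrArg (· ∈ B) (hft t ξ ξ' h))
  · intro s t hst
    exact Set.disjoint_left.2 fun ξ h1 h2 => Set.disjoint_left.1 (pairwise_disjoint_block hst)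
      ⟨h1.1.1, h1.2.1⟩ ⟨h2.1.1, h2.2.1⟩
  · exact fun t => ((measurableSet_isBlock t).inter (hf t hB)).inter
      (measurable_shift t (measurableSet_stays.inter hA))

theorem noiseLaw_stays_inter_atRegen (hβ : 717 ≤ β) {α : Type*} [MeasurableSpace α]
    {f : ℕ → (ℕ → Mark) → α} (hf : ∀ t, Measurable (f t)) (hft : ∀ t, DependsOnPast t (f t))
    {B : Set α} (hB : MeasurableSet B) :
    noiseLaw p β ({ξ | Stays ξ} ∩ atRegen f ⁻¹' B) =
      (∑' t, noiseLaw p β ({ξ | IsBlock ξ t} ∩ f t ⁻¹' B)) * noiseLaw p β {ξ | Stays ξ} := by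
  simpa using noiseLaw_stays_inter p hβ hf hft hB MeasurableSet.univ

/-- For trivial `f` the product formula reads `P(Stays) = c * P(Stays)` with `c` the sum; the
probability is positive and finite, so it cancels. -/
theorem tsum_noiseLaw_isBlock (hβ : 717 ≤ β) :
    ∑' t, noiseLaw p β {ξ | IsBlock ξ t} = 1 := by
  have h := noiseLaw_stays_inter_atRegen p hβ (f := fun _ _ => ()) (fun _ => measurable_const)
    (fun _ _ _ _ => rfl) MeasurableSet.univ
  simp only [Set.preimage_univ, Set.inter_univ] at h
  exact ((ENNReal.mul_eq_right (noiseLaw_stays_ne_zero p hβ) (measure_ne_top _ _)).1 h.symm)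

/-- What a regeneration requires of the future is exactly the event on which `stayLaw` conditions.
-/
theorem measurePreserving_renew (hβ : 717 ≤ β) :
    MeasurePreserving renew (stayLaw p β) (stayLaw p β) := by
  refine ⟨measurable_renew, Measure.ext fun A hA => ?_⟩
  have h := noiseLaw_stays_inter p hβ (f := fun _ _ => ()) (fun _ => measurable_const)
    (fun _ _ _ _ => rfl) MeasurableSet.univ hA
  simp only [Set.preimage_univ, Set.univ_inter, Set.inter_univ, tsum_noiseLaw_isBlock p hβ,
    one_mul] at h
  rw [Measure.map_apply measurable_renew hA, stayLaw, cond_apply measurableSet_stays,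
    cond_apply measurableSet_stays, h]

theorem indepFun_renew (hβ : 717 ≤ β) {α : Type*} [MeasurableSpace α]
    {f : ℕ → (ℕ → Mark) → α} (hf : ∀ t, Measurable (f t)) (hft : ∀ t, DependsOnPast t (f t)) :
    IndepFun (atRegen f) renew (stayLaw p β) := by
  rw [indepFun_iff_measure_inter_preimage_eq_mul]
  intro B A hB hA
  have h0 := noiseLaw_stays_ne_zero p hβ
  rw [(measurePreserving_renew p hβ).measure_preimage hA.nullMeasurableSet]
  simp only [stayLaw, cond_apply measurableSet_stays]
  rw [noiseLaw_stays_inter p hβ hf hft hB hA, noiseLaw_stays_inter_atRegen p hβ hf hft hB,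
    mul_left_comm, mul_comm _ (noiseLaw p β {ξ | Stays ξ}),
    ENNReal.inv_mul_cancel_left h0 (measure_ne_top _ _)]

/-- The law of large numbers for the values of a process over the blocks. -/
theorem tendsto_sum_atRegen (hβ : 717 ≤ β) {f : ℕ → (ℕ → Mark) → ℝ}
    (hf : ∀ t, Measurable (f t)) (hft : ∀ t, DependsOnPast t (f t))
    (hint : Integrable (atRegen f) (stayLaw p β)) :
    ∀ᵐ ξ ∂stayLaw p β, Tendsto
      (fun n : ℕ => (∑ i ∈ Finset.range n, atRegen f (renew^[i] ξ)) / n) atTop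
      (𝓝 (∫ ξ, atRegen f ξ ∂stayLaw p β)) := by
  have hm := measurable_atRegen hf
  have hpres : ∀ i, MeasurePreserving renew^[i] (stayLaw p β) (stayLaw p β) := fun i =>
    (measurePreserving_renew p hβ).iterate i
  have hlt : ∀ i j, i < j → IndepFun (fun ξ => atRegen f (renew^[i] ξ))
      (fun ξ => atRegen f (renew^[j] ξ)) (stayLaw p β) := by
    intro i j hij
    obtain ⟨k, rfl⟩ := Nat.exists_eq_add_of_lt hij
    have h1 : IndepFun (atRegen f) (fun ξ => atRegen f (renew^[k] (renew ξ))) (stayLaw p β) :=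
      (indepFun_renew p hβ hf hft).comp measurable_id (hm.comp (measurable_renew.iterate k))
    rw [indepFun_iff_measure_inter_preimage_eq_mul] at h1 ⊢
    intro B C hB hC
    have h2 := h1 B C hB hC
    have hm' : Measurable fun ξ => atRegen f (renew^[k] (renew ξ)) :=
      hm.comp ((measurable_renew.iterate k).comp measurable_renew)
    rw [← (hpres i).measure_preimage ((hm hB).inter (hm' hC)).nullMeasurableSet,
      ← (hpres i).measure_preimage (hm hB).nullMeasurableSet,
      ← (hpres i).measure_preimage (hm' hC).nullMeasurableSet] at h2
    have h3 : ∀ ξ, renew^[i + k + 1] ξ = renew^[k] (renew (renew^[i] ξ)) := fun ξ => by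
      rw [← Function.iterate_succ_apply, ← Function.iterate_add_apply]
      congr 1
      omega
    simp only [h3]
    exact h2
  refine strong_law_ae_real (fun i ξ => atRegen f (renew^[i] ξ)) hint (fun i j hij => ?_)
    fun i => ⟨(hm.comp (measurable_renew.iterate i)).aemeasurable, hm.aemeasurable, ?_⟩
  · rcases lt_or_gt_of_ne hij with h | h
    · exact hlt i j h
    · exact (hlt j i h).symm
  · change Measure.map (atRegen f ∘ renew^[i]) _ = _
    rw [← Measure.map_map hm (measurable_renew.iterate i), (hpres i).map_eq]
    rfl

theorem stayLaw_atRegen (hβ : 717 ≤ β) {α : Type*} [MeasurableSpace α]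
    {f : ℕ → (ℕ → Mark) → α} (hf : ∀ t, Measurable (f t)) (hft : ∀ t, DependsOnPast t (f t))
    {B : Set α} (hB : MeasurableSet B) :
    stayLaw p β (atRegen f ⁻¹' B) = ∑' t, noiseLaw p β ({ξ | IsBlock ξ t} ∩ f t ⁻¹' B) := by
  rw [stayLaw, cond_apply measurableSet_stays, noiseLaw_stays_inter_atRegen p hβ hf hft hB,
    mul_comm (∑' t, _), ENNReal.inv_mul_cancel_left (noiseLaw_stays_ne_zero p hβ)
    (measure_ne_top _ _)]

theorem lintegral_natCast_eq_tsum {Ω : Type*} [MeasurableSpace Ω] (μ : Measure Ω) {f : Ω → ℕ}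
    (hf : Measurable f) : ∫⁻ ω, (f ω : ℝ≥0∞) ∂μ = ∑' v : ℕ, (v : ℝ≥0∞) * μ (f ⁻¹' {v}) := by
  have : ∫⁻ ω, (f ω : ℝ≥0∞) ∂μ = ∫⁻ v : ℕ, (v : ℝ≥0∞) ∂μ.map f := by
    rw [lintegral_map (measurable_of_countable _) hf]
  rw [this, lintegral_countable']
  exact tsum_congr fun v => by rw [Measure.map_apply hf (measurableSet_singleton v)]

/-- Removes the conditioning: expectations over the first block become sums over block lengths under
the i.i.d. law, where exponential moments are computable. -/
theorem lintegral_atRegen (hβ : 717 ≤ β) {f : ℕ → (ℕ → Mark) → ℕ}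
    (hf : ∀ t, Measurable (f t)) (hft : ∀ t, DependsOnPast t (f t)) :
    ∫⁻ ξ, ((atRegen f ξ : ℕ) : ℝ≥0∞) ∂stayLaw p β =
      ∑' t, ∫⁻ ξ in {ξ | IsBlock ξ t}, (f t ξ : ℝ≥0∞) ∂noiseLaw p β := by
  rw [lintegral_natCast_eq_tsum _ (measurable_atRegen hf)]
  simp_rw [lintegral_natCast_eq_tsum _ (hf _),
    stayLaw_atRegen p hβ hf hft (measurableSet_singleton _), ← ENNReal.tsum_mul_left]
  rw [ENNReal.tsum_comm]
  refine tsum_congr fun t => tsum_congr fun v => ?_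
  rw [Measure.restrict_apply (hf t (measurableSet_singleton v)), Set.inter_comm]

theorem lintegral_regenTime_ne_top (hβ : 717 ≤ β) :
    ∫⁻ ξ, (regenTime ξ : ℝ≥0∞) ∂stayLaw p β ≠ ∞ := by
  have h1 := lintegral_atRegen p hβ (f := fun t _ => t) (fun _ => measurable_const)
    (fun _ _ _ _ => rfl)
  simp only [setLIntegral_const] at h1
  change ∫⁻ ξ, (regenTime ξ : ℝ≥0∞) ∂stayLaw p β = _ at h1
  rw [h1]
  refine ne_top_of_le_ne_top ?_ (ENNReal.tsum_le_tsum fun t =>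
    mul_le_mul_right (noiseLaw_isBlock_le p hβ t) (t : ℝ≥0∞))
  have h2 : Summable fun t : ℕ => ((t : ℝ≥0) * (7 * (3 / 14) ^ t)) := by
    rw [← NNReal.summable_coe]
    push_cast
    have := (summable_pow_mul_geometric_of_norm_lt_one 1 (r := (3 / 14 : ℝ))
      (by rw [Real.norm_eq_abs, abs_of_pos] <;> norm_num)).mul_left 7
    refine this.congr fun t => by ring
  have h3 := ENNReal.tsum_coe_ne_top_iff_summable.2 h2
  simpa only [ENNReal.coe_mul, ENNReal.coe_natCast] using h3

end Renewal

/-! ### From renewal times to the speed -/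

theorem tendsto_natCast_add_div_natCast (c : ℝ) :
    Tendsto (fun n : ℕ => ((n : ℝ) + c) / n) atTop (𝓝 1) := by
  have h := (tendsto_const_div_atTop_nhds_zero_nat c).const_add 1
  rw [add_zero] at h
  refine h.congr' ?_
  filter_upwards [eventually_gt_atTop 0] with n hn
  have hn' : (0 : ℝ) < n := by exact_mod_cast hn
  field_simp

/-- If a sequence which decreases by at most one in each step has a rate along the renewal times
`τ`, and these have a rate, then it has a rate. -/
theorem tendsto_div_of_renewal {x τ : ℕ → ℕ} (hx : ∀ n, x n ≤ x (n + 1) + 1) (hτ : ∀ n, n ≤ τ n)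
    {a b : ℝ} (ha : 0 < a) (hτa : Tendsto (fun n : ℕ => (τ n : ℝ) / n) atTop (𝓝 a))
    (hxb : Tendsto (fun n : ℕ => (x (τ n) : ℝ) / n) atTop (𝓝 b)) :
    Tendsto (fun n : ℕ => (x n : ℝ) / n) atTop (𝓝 (b / a)) := by
  -- `x` need not be monotone, but adding `n` makes it so and only shifts the rate by one.
  have hmono : Monotone fun n : ℕ => (x n : ℝ) + n := monotone_nat_of_le_succ fun n => by
    have : (x n : ℝ) ≤ x (n + 1) + 1 := by exact_mod_cast hx n
    push_cast
    linarith
  have hτ1 : ∀ n, 0 < n → (0 : ℝ) < τ n := fun n hn => by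
    exact_mod_cast hn.trans_le (hτ n)
  have hratio : Tendsto (fun n : ℕ => (τ (n + 1) : ℝ) / τ n) atTop (𝓝 1) := by
    have h1 := (hτa.comp (tendsto_add_atTop_nat 1)).mul
      (tendsto_natCast_add_div_natCast (1 : ℝ))
    have h2 := h1.div hτa ha.ne'
    rw [mul_one, div_self ha.ne'] at h2
    refine h2.congr' ?_
    filter_upwards [eventually_gt_atTop 0] with n hn
    have hn' : (0 : ℝ) < n := by exact_mod_cast hn
    have := hτ1 n hn
    simp only [Function.comp, Pi.div_apply]
    push_cast
    field_simp
  have hkey := tendsto_div_of_monotone_of_exists_subseq_tendsto_div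
    (fun n : ℕ => (x n : ℝ) + n) (b / a + 1) hmono fun c hc => by
      refine ⟨τ, ?_, tendsto_atTop_mono hτ tendsto_id, ?_⟩
      · filter_upwards [hratio.eventually (gt_mem_nhds hc), eventually_gt_atTop 0] with n h hn
        exact ((div_lt_iff₀ (hτ1 n hn)).1 h).le
      · refine ((hxb.div hτa ha.ne').add_const 1).congr' ?_
        filter_upwards [eventually_gt_atTop 0] with n hn
        have hn' : (0 : ℝ) < n := by exact_mod_cast hn
        have := hτ1 n hn
        simp only [Pi.div_apply]
        field_simp
  have h := hkey.sub_const 1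
  rw [add_sub_cancel_right] at h
  refine h.congr' ?_
  filter_upwards [eventually_gt_atTop 0] with n hn
  have hn' : (0 : ℝ) < n := by exact_mod_cast hn
  field_simp
  ring

section Speed

variable (p : PMF ℕ) {β : ℝ≥0} (β' : ℝ≥0)

theorem isRegen_regenTime {ξ : ℕ → Mark} (h : ∃ t, IsRegen ξ t) : IsRegen ξ (regenTime ξ) :=
  Nat.sInf_mem (s := {t | IsRegen ξ t}) h

theorem depth_add_regenTime {ξ : ℕ → Mark} (h : ∃ t, IsRegen ξ t) (m : ℕ) :
    depth β β' ξ (regenTime ξ + m) = depth β β' ξ (regenTime ξ) + depth β β' (renew ξ) m :=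
  depth_add_of_fresh (isRegen_regenTime h).2.1 (isRegen_regenTime h).2.2 m

theorem depth_add_sum_regenTime {ξ : ℕ → Mark} (h : ∀ i, ∃ t, IsRegen (renew^[i] ξ) t)
    (n m : ℕ) :
    depth β β' ξ (∑ i ∈ Finset.range n, regenTime (renew^[i] ξ) + m) =
      ∑ i ∈ Finset.range n, depth β β' (renew^[i] ξ) (regenTime (renew^[i] ξ)) +
        depth β β' (renew^[n] ξ) m := by
  induction n generalizing m with
  | zero => simp
  | succ n ih =>
    rw [Finset.sum_range_succ, Finset.sum_range_succ, add_assoc, ih, depth_add_regenTime β' (h n),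
      ← Function.iterate_succ_apply' renew, add_assoc]

theorem ae_stayLaw {P : (ℕ → Mark) → Prop} (h : ∀ᵐ ξ ∂noiseLaw p β, P ξ) :
    ∀ᵐ ξ ∂stayLaw p β, P ξ :=
  cond_absolutelyContinuous.ae_le h

theorem integrable_regenTime (hβ : 717 ≤ β) :
    Integrable (fun ξ => (regenTime ξ : ℝ)) (stayLaw p β) := by
  refine ⟨((measurable_of_countable _).comp measurable_regenTime).aestronglyMeasurable, ?_⟩
  rw [hasFiniteIntegral_iff_enorm]
  refine lt_of_le_of_ne le_top ?_
  simpa using lintegral_regenTime_ne_top p hβ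

theorem measurable_depth_regenTime : Measurable fun ξ => (depth β β' ξ (regenTime ξ) : ℝ) :=
  (measurable_of_countable fun n : ℕ => (n : ℝ)).comp
    (measurable_atRegen (f := fun t ξ => depth β β' ξ t) fun t => measurable_depth t)

theorem integrable_depth_regenTime (hβ : 717 ≤ β) :
    Integrable (fun ξ => (depth β β' ξ (regenTime ξ) : ℝ)) (stayLaw p β) := by
  refine (integrable_regenTime p hβ).mono (measurable_depth_regenTime β').aestronglyMeasurable
    (ae_of_all _ fun ξ => ?_)
  simpa using depth_le ξ (regenTime ξ)

theorem one_le_integral_regenTime (hβ : 717 ≤ β) :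
    1 ≤ ∫ ξ, (regenTime ξ : ℝ) ∂stayLaw p β := by
  have := isProbabilityMeasure_stayLaw p hβ
  have h : ∫ _, (1 : ℝ) ∂stayLaw p β ≤ ∫ ξ, (regenTime ξ : ℝ) ∂stayLaw p β := by
    refine integral_mono_ae (integrable_const _) (integrable_regenTime p hβ) ?_
    filter_upwards [ae_stayLaw p (ae_exists_isRegen p hβ)] with ξ hξ
    exact_mod_cast (isRegen_regenTime hξ).1
  simpa using h

theorem tendsto_depth_div_stayLaw (hβ : 717 ≤ β) :
    ∀ᵐ ξ ∂stayLaw p β, Tendsto (fun n : ℕ => (depth β β' ξ n : ℝ) / n) atTop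
      (𝓝 ((∫ ξ, (depth β β' ξ (regenTime ξ) : ℝ) ∂stayLaw p β) /
        ∫ ξ, (regenTime ξ : ℝ) ∂stayLaw p β)) := by
  have hreg : ∀ᵐ ξ ∂stayLaw p β, ∀ i, ∃ t, IsRegen (renew^[i] ξ) t :=
    ae_all_iff.2 fun i => ((measurePreserving_renew p hβ).iterate i).quasiMeasurePreserving.ae
      (ae_stayLaw p (ae_exists_isRegen p hβ))
  have h1 := tendsto_sum_atRegen p hβ (f := fun t _ => (t : ℝ)) (fun _ => measurable_const)
    (fun _ _ _ _ => rfl) (integrable_regenTime p hβ)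
  have h2 := tendsto_sum_atRegen p hβ (f := fun t ξ => (depth β β' ξ t : ℝ))
    (fun t => (measurable_of_countable fun n : ℕ => (n : ℝ)).comp (measurable_depth t))
    (fun t ξ ξ' h => congrArg Nat.cast (depth_congr h)) (integrable_depth_regenTime p β' hβ)
  filter_upwards [hreg, h1, h2] with ξ hξ h1 h2
  refine tendsto_div_of_renewal (τ := fun n => ∑ i ∈ Finset.range n, regenTime (renew^[i] ξ))
    (le_depth_succ ξ) (fun n => ?_)
    (zero_lt_one.trans_le (one_le_integral_regenTime p hβ)) ?_ ?_
  · calc n = ∑ i ∈ Finset.range n, 1 := by simp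
      _ ≤ _ := Finset.sum_le_sum fun i _ => (isRegen_regenTime (hξ i)).1
  · simpa [atRegen] using h1
  · refine h2.congr fun n => ?_
    have := depth_add_sum_regenTime (β := β) β' hξ n 0
    simp only [add_zero] at this
    rw [this]
    simp [atRegen, depth, lazyState]

/-- The walk which discovers its environment has a deterministic speed. -/
theorem tendsto_depth_div_noiseLaw (hβ : 717 ≤ β) :
    ∀ᵐ ξ ∂noiseLaw p β, Tendsto (fun n : ℕ => (depth β β' ξ n : ℝ) / n) atTop
      (𝓝 ((∫ ξ, (depth β β' ξ (regenTime ξ) : ℝ) ∂stayLaw p β) /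
        ∫ ξ, (regenTime ξ : ℝ) ∂stayLaw p β)) := by
  set v := (∫ ξ, (depth β β' ξ (regenTime ξ) : ℝ) ∂stayLaw p β) /
        ∫ ξ, (regenTime ξ : ℝ) ∂stayLaw p β
  have h := tendsto_depth_div_stayLaw p β' hβ
  have h0 : ∀ᵐ ξ ∂noiseLaw p β, Stays ξ →
      Tendsto (fun n : ℕ => (depth β β' ξ n : ℝ) / n) atTop (𝓝 v) := by
    have h' := (Measure.ae_ennreal_smul_measure_iff
      (ENNReal.inv_ne_zero.2 (measure_ne_top _ _))).1 h
    exact (ae_restrict_iff' measurableSet_stays).1 h'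
  -- The noise after a regeneration time stays nonnegative, so it suffices to know the limit
  -- simultaneously for all shifts that stay; the initial piece adds only a constant depth.
  have h1 : ∀ᵐ ξ ∂noiseLaw p β, ∀ t, Stays (shift t ξ) →
      Tendsto (fun n : ℕ => (depth β β' (shift t ξ) n : ℝ) / n) atTop (𝓝 v) :=
    ae_all_iff.2 fun t => (measurePreserving_shift p β t).quasiMeasurePreserving.ae h0
  filter_upwards [ae_exists_isRegen p hβ, h1] with ξ ⟨t, ht⟩ h1
  have h2 := h1 t ht.2.2
  have h3 : Tendsto (fun n : ℕ => (depth β β' ξ (n + t) : ℝ) / (n + t : ℕ)) atTop (𝓝 v) := by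
    have h4 : Tendsto (fun n : ℕ => (depth β β' ξ t : ℝ) / n) atTop (𝓝 0) :=
      tendsto_const_div_atTop_nhds_zero_nat _
    have h5 := (h4.add h2).div (tendsto_natCast_add_div_natCast (t : ℝ)) one_ne_zero
    rw [zero_add, div_one] at h5
    refine h5.congr' ?_
    filter_upwards [eventually_gt_atTop 0] with n hn
    have hn' : (0 : ℝ) < n := by exact_mod_cast hn
    rw [add_comm n t, depth_add_of_fresh ht.2.1 ht.2.2]
    simp only [Pi.div_apply]
    push_cast
    field_simp
    ring
  exact (tendsto_add_atTop_iff_nat t).1 h3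

end Speed

/-! ### The law of one step of the coupled walk -/

section StepLaw

variable {β β' : ℝ≥0}

theorem unitLaw_floor {k : ℕ} (hk : k ≠ 0) (i : ℕ) :
    unitLaw {c | ⌊c * k⌋₊ = i} = if i < k then ((1 / k : ℝ≥0) : ℝ≥0∞) else 0 := by
  have hk' : (0 : ℝ) < k := by exact_mod_cast Nat.pos_of_ne_zero hk
  have hm : MeasurableSet {c : ℝ | ⌊c * k⌋₊ = i} :=
    (Nat.measurable_floor.comp (measurable_id.mul_const (k : ℝ))) (measurableSet_singleton i)
  rw [unitLaw, Measure.restrict_apply hm]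
  split_ifs with h
  · have : {c : ℝ | ⌊c * k⌋₊ = i} ∩ Set.Ico 0 1 = Set.Ico ((i : ℝ) / k) ((i + 1 : ℝ) / k) := by
      ext c
      have hik : (i : ℝ) + 1 ≤ k := by exact_mod_cast h
      simp only [Set.mem_inter_iff, Set.mem_ofPred_eq, Set.mem_Ico]
      rw [div_le_iff₀ hk', lt_div_iff₀ hk']
      constructor
      · rintro ⟨hfl, h0, -⟩
        exact (Nat.floor_eq_iff (by positivity)).1 hfl
      · rintro ⟨h1, h2⟩
        have h0 : 0 ≤ c := by
          by_contra! hc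
          have := mul_neg_of_neg_of_pos hc hk'
          have : (0 : ℝ) ≤ i := by positivity
          linarith
        refine ⟨(Nat.floor_eq_iff (by positivity)).2 ⟨h1, h2⟩, h0, ?_⟩
        by_contra! hc
        have : (1 : ℝ) * k ≤ c * k := by gcongr
        linarith
    rw [this, Real.volume_Ico, ← sub_div, add_sub_cancel_left,
      show (1 / k : ℝ) = ((1 / k : ℝ≥0) : ℝ) by push_cast; rfl, ENNReal.ofReal_coe_nnreal]
  · have : {c : ℝ | ⌊c * k⌋₊ = i} ∩ Set.Ico 0 1 = ∅ := by
      refine Set.eq_empty_of_forall_notMem ?_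
      rintro c ⟨hc, h0, h1⟩
      have h2 : c * k < k := by nlinarith
      have := (Nat.floor_lt (by positivity)).2 h2
      simp only [Set.mem_ofPred_eq] at hc
      omega
    rw [this, measure_empty]

theorem unitLaw_lt {θ : ℝ≥0} (hθ : θ ≤ 1) : unitLaw {e | e < (θ : ℝ)} = θ := by
  have hθ' : (θ : ℝ) ≤ 1 := by exact_mod_cast hθ
  have : {e : ℝ | e < θ} ∩ Set.Ico 0 1 = Set.Ico 0 (θ : ℝ) := by
    ext e
    simp only [Set.mem_inter_iff, Set.mem_ofPred_eq, Set.mem_Ico]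
    constructor
    · rintro ⟨h1, h2, -⟩; exact ⟨h2, h1⟩
    · rintro ⟨h1, h2⟩; exact ⟨h2, h1, by linarith⟩
  rw [unitLaw, Measure.restrict_apply (measurableSet_lt measurable_id' measurable_const), this,
    Real.volume_Ico, sub_zero, ENNReal.ofReal_coe_nnreal]

/-- Here `β ≤ β'` is essential: it lets the back step of the `β'`-walk be a thinning of the flag. -/
theorem threshold_le_one (h : β ≤ β') {k : ℕ} (hk : k ≠ 0) : (1 + β) / (1 + β' * k) ≤ 1 := by
  refine div_le_one_of_le₀ ?_ (by positivity)
  have : (1 : ℝ≥0) ≤ k := by exact_mod_cast Nat.one_le_iff_ne_zero.2 hk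
  gcongr
  calc β ≤ β' * 1 := by simpa using h
    _ ≤ β' * k := by gcongr

theorem moveLaw_floor {k : ℕ} (hk : k ≠ 0) (i : ℕ) :
    moveLaw β {m | ⌊m.2.2 * k⌋₊ = i} = if i < k then ((1 / k : ℝ≥0) : ℝ≥0∞) else 0 := by
  have : {m : Move | ⌊m.2.2 * k⌋₊ = i} =
      Set.univ ×ˢ (Set.univ ×ˢ {c : ℝ | ⌊c * k⌋₊ = i}) := by ext; simp
  rw [this, moveLaw, Measure.prod_prod, Measure.prod_prod, measure_univ, measure_univ,
    unitLaw_floor hk, one_mul, one_mul]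

theorem moveLaw_back (h : β ≤ β') {k : ℕ} (hk : k ≠ 0) :
    moveLaw β {m | m.1 = true ∧ m.2.1 < backThreshold β β' k} =
      ((1 / (1 + β' * k) : ℝ≥0) : ℝ≥0∞) := by
  have : {m : Move | m.1 = true ∧ m.2.1 < backThreshold β β' k} =
      {true} ×ˢ ({e | e < (((1 + β) / (1 + β' * k) : ℝ≥0) : ℝ)} ×ˢ Set.univ) := by
    ext m; simp [backThreshold]
  rw [this, moveLaw, Measure.prod_prod, Measure.prod_prod, measure_univ, flagLaw_true,
    unitLaw_lt (threshold_le_one h hk), mul_one, ← ENNReal.coe_mul]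
  congr 1
  field_simp

theorem moveLaw_back_inter_floor (h : β ≤ β') {k : ℕ} (hk : k ≠ 0) (i : ℕ) :
    moveLaw β ({m | ⌊m.2.2 * k⌋₊ = i} ∩ {m | m.1 = true ∧ m.2.1 < backThreshold β β' k}) =
      if i < k then ((1 / (1 + β' * k) * (1 / k) : ℝ≥0) : ℝ≥0∞) else 0 := by
  have : {m : Move | ⌊m.2.2 * k⌋₊ = i} ∩ {m | m.1 = true ∧ m.2.1 < backThreshold β β' k} =
      {true} ×ˢ ({e | e < (((1 + β) / (1 + β' * k) : ℝ≥0) : ℝ)} ×ˢ {c : ℝ | ⌊c * k⌋₊ = i}) := by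
    ext m; simp [backThreshold]; tauto
  rw [this, moveLaw, Measure.prod_prod, Measure.prod_prod, flagLaw_true,
    unitLaw_lt (threshold_le_one h hk), unitLaw_floor hk]
  split_ifs
  · rw [← ENNReal.coe_mul, ← ENNReal.coe_mul]
    congr 1
    field_simp
  · simp

/-- The child mark gives `i` with probability `1 / k`, independently of the back step, and `(1 / k)
* (1 - 1 / (1 + β' k)) = β' / (1 + β' k)`. -/
theorem moveLaw_floor_diff_back (h : β ≤ β') {k : ℕ} (hk : k ≠ 0) (i : ℕ) :
    moveLaw β ({m | ⌊m.2.2 * k⌋₊ = i} \ {m | m.1 = true ∧ m.2.1 < backThreshold β β' k}) =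
      if i < k then ((β' / (1 + β' * k) : ℝ≥0) : ℝ≥0∞) else 0 := by
  have hm : MeasurableSet {m : Move | m.1 = true ∧ m.2.1 < backThreshold β β' k} :=
    (measurable_fst (measurableSet_singleton true)).inter
      (measurableSet_lt measurable_snd.fst measurable_const)
  have h1 := measure_sdiff_add_inter (μ := moveLaw β) {m : Move | ⌊m.2.2 * k⌋₊ = i} hm
  rw [moveLaw_back_inter_floor h hk, moveLaw_floor hk] at h1
  split_ifs at h1 ⊢
  · refine (ENNReal.add_left_inj (ENNReal.coe_ne_top
      (r := (1 / (1 + β' * k) * (1 / k) : ℝ≥0)))).1 (h1.trans ?_)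
    rw [← ENNReal.coe_add]
    congr 1
    field_simp
    ring
  · simpa using h1

/-- The conditional law of a step, given the number of children. -/
theorem moveLaw_move (h : β ≤ β') (k : ℕ) (x x' : Vertex) :
    moveLaw β {m | move β β' k m x = x'} = stepLaw β' k x {x'} := by
  classical
  have hdir : ∀ (c : ℝ≥0∞) (f : ℕ → Vertex) (i : ℕ), Function.Injective f →
      (∑ j ∈ Finset.range k, c * Measure.dirac (f j) {f i}) = if i < k then c else 0 := by
    intro c f i hf
    simp [Set.indicator, hf.eq_iff, Finset.sum_ite_eq']
  cases x with
  | nil =>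
    by_cases hk : k = 0
    · simp only [move, stepLaw, hk, if_true]
      by_cases hx : ([] : Vertex) = x'
      · simp [hx]
      · simp [hx]
    · simp only [move, stepLaw, hk, if_false, Measure.coe_finsetSum, Finset.sum_apply,
        Measure.smul_apply, smul_eq_mul]
      by_cases hx : ∃ i, x' = [i]
      · obtain ⟨i, rfl⟩ := hx
        rw [hdir _ (fun i => [i]) i fun _ _ h => by simpa using h, ← moveLaw_floor (β := β) hk i]
        simp
      · push Not at hx
        have h1 : {m : Move | ([⌊m.2.2 * k⌋₊] : Vertex) = x'} = ∅ :=
          Set.eq_empty_of_forall_notMem fun m hm => hx _ hm.symm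
        rw [h1, measure_empty]
        refine (Finset.sum_eq_zero fun i _ => ?_).symm
        simp [Ne.symm (hx i)]
  | cons a y =>
    by_cases hk : k = 0
    · simp only [move, stepLaw, hk]
      by_cases hx : y = x'
      · simp [hx]
      · simp [hx]
    · simp only [move, stepLaw, hk, false_or, Measure.coe_finsetSum, Finset.sum_apply,
        Measure.smul_apply, smul_eq_mul, Measure.coe_add, Pi.add_apply]
      by_cases hy : x' = y
      · subst hy
        have h1 : {m : Move | (if m.1 = true ∧ m.2.1 < backThreshold β β' k then x'
            else ⌊m.2.2 * k⌋₊ :: a :: x') = x'} =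
            {m | m.1 = true ∧ m.2.1 < backThreshold β β' k} := by
          ext m
          simp only [Set.mem_ofPred_eq]
          split_ifs with hc
          · simp [hc]
          · simp only [hc, iff_false]
            intro hlen
            have := congrArg List.length hlen
            simp at this
            omega
        rw [h1, moveLaw_back h hk, Finset.sum_eq_zero fun i _ => ?_]
        · simp
        · have : i :: a :: x' ≠ x' := fun hlen => by
            have := congrArg List.length hlen
            simp at this
            omega
          simp [this]
      · by_cases hx : ∃ i, x' = i :: a :: y
        · obtain ⟨i, rfl⟩ := hx
          rw [hdir _ (fun i => i :: a :: y) i fun _ _ h => by simpa using h,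
            ← moveLaw_floor_diff_back h hk]
          have h2 : y ≠ i :: a :: y := Ne.symm hy
          simp only [Measure.dirac_apply, Set.indicator, Set.mem_singleton_iff, h2, if_false,
            mul_zero, zero_add]
          congr 1
          ext m
          simp only [Set.mem_ofPred_eq, Set.mem_sdiff]
          split_ifs with hc
          · simp [h2, hc]
          · simp only [List.cons.injEq, and_true]
            exact ⟨fun h => ⟨h, hc⟩, fun h => h.1⟩
        · push Not at hx
          have h1 : {m : Move | (if m.1 = true ∧ m.2.1 < backThreshold β β' k then y
            else ⌊m.2.2 * k⌋₊ :: a :: y) = x'} = ∅ := by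
            refine Set.eq_empty_of_forall_notMem fun m hm => ?_
            simp only [Set.mem_ofPred_eq] at hm
            split_ifs at hm
            · exact hy hm.symm
            · exact hx _ hm.symm
          rw [h1, measure_empty, Finset.sum_eq_zero fun i _ => ?_]
          · simp [Ne.symm hy]
          · simp [Ne.symm (hx i)]

end StepLaw

/-! ### Identification of the lazy walk with the averaged law -/

section Law

variable {p : PMF ℕ} {β β' : ℝ≥0}

/-- The probability to see the number of children `k` at `x` after the history `h`. -/
def degreeWeight (p : PMF ℕ) (x : Vertex) (h : List (Vertex × ℕ)) (k : ℕ) : ℝ≥0∞ :=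
  match h.lookup x with
  | none => p k
  | some k' => if k' = k then 1 else 0

/-- Absence of leaves ensures that replacing `d` by `max 1 d` does not change the law of the
degrees. -/
theorem toMeasure_max_one (hp : p 0 = 0) (k : ℕ) : p.toMeasure {d | max 1 d = k} = p k := by
  have h0 : ∀ᵐ d ∂p.toMeasure, d ≠ 0 := by
    refine measure_eq_zero_iff_ae_notMem (s := {0}).1 ?_
    rw [PMF.toMeasure_apply_singleton _ _ (measurableSet_singleton _), hp]
  rw [← PMF.toMeasure_apply_singleton p k (measurableSet_singleton k)]
  refine measure_congr ?_
  filter_upwards [h0] with d hd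
  refine propext ?_
  change max 1 d = k ↔ d = k
  omega

theorem markLaw_next (hp : p 0 = 0) (h : β ≤ β') (x : Vertex) (l : List (Vertex × ℕ)) (k : ℕ)
    (x' : Vertex) :
    markLaw p β {m | degree (x, l) m.2 = k ∧ move β β' k m.1 x = x'} =
      degreeWeight p x l k * stepLaw β' k x {x'} := by
  have : {m : Mark | degree (x, l) m.2 = k ∧ move β β' k m.1 x = x'} =
      {m | move β β' k m x = x'} ×ˢ {d | degree (x, l) d = k} := by
    ext m; simp [and_comm]
  rw [this, markLaw, Measure.prod_prod, moveLaw_move h, mul_comm]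
  congr 1
  unfold degree degreeWeight
  cases l.lookup x with
  | none => simpa using toMeasure_max_one hp k
  | some k' =>
    by_cases hk : k' = k <;> simp [hk]

theorem noiseLaw_lazyState_zero (s : State) :
    noiseLaw p β {ξ | lazyState β β' ξ 0 = s} = if s = ([], []) then 1 else 0 := by
  by_cases hs : s = ([], [])
  · simp [lazyState, hs]
  · simp [lazyState, hs, Ne.symm hs]

theorem noiseLaw_lazyState_succ (hp : p 0 = 0) (h : β ≤ β') (n : ℕ) (x : Vertex)
    (l : List (Vertex × ℕ)) (k : ℕ) (x' : Vertex) :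
    noiseLaw p β {ξ | lazyState β β' ξ (n + 1) = (x', (x, k) :: l)} =
      noiseLaw p β {ξ | lazyState β β' ξ n = (x, l)} *
        (degreeWeight p x l k * stepLaw β' k x {x'}) := by
  have hM : MeasurableSet {m : Mark | degree (x, l) m.2 = k ∧ move β β' k m.1 x = x'} :=
    ((measurable_of_countable (degree (x, l))).comp measurable_snd
      (measurableSet_singleton k)).inter
      (((measurable_move k x).comp measurable_fst) (measurableSet_singleton x'))
  have hev := measurePreserving_eval_infinitePi (fun _ : ℕ => markLaw p β) 0
  rw [← markLaw_next hp h, ← hev.measure_preimage hM.nullMeasurableSet]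
  change _ = _ * noiseLaw p β _
  have hst : MeasurableSet {ξ | lazyState β β' ξ n = (x, l)} :=
    (measurable_lazyState n) (measurableSet_singleton (x, l))
  rw [← noiseLaw_inter_shift p β (t := n) hst
    (fun ξ ξ' hξ => by
      change (lazyState β β' ξ n = (x, l)) = (lazyState β β' ξ' n = (x, l))
      rw [lazyState_congr hξ])
    (hev.measurable hM)]
  congr 1
  ext ξ
  simp only [lazyState_succ, next, Prod.mk.injEq, List.cons.injEq, Set.mem_inter_iff,
    Set.mem_preimage, Set.mem_ofPred_eq, shift, Function.eval, add_zero]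
  constructor
  · rintro ⟨h1, ⟨h2, h3⟩, h4⟩
    have hs : lazyState β β' ξ n = (x, l) := Prod.ext h2 h4
    rw [hs] at h3 h1
    rw [h3] at h1
    exact ⟨hs, h3, h1⟩
  · rintro ⟨h1, h2, h3⟩
    rw [h1]
    exact ⟨h2.symm ▸ h3, ⟨rfl, h2⟩, rfl⟩

/-- The environment has the numbers of children that were recorded. -/
def Matches (l : List (Vertex × ℕ)) (ω : Env) : Prop := ∀ e ∈ l, ω e.1 = e.2

theorem measurableSet_matches (l : List (Vertex × ℕ)) : MeasurableSet {ω | Matches l ω} := by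
  simp only [Matches, Set.ofPred_forall]
  exact MeasurableSet.iInter fun e => MeasurableSet.iInter fun _ =>
    (measurable_pi_apply e.1 : Measurable fun ω : Env => ω e.1) (measurableSet_singleton e.2)

/-- A label already present adds either nothing or a contradiction; a new one is independent of the
others. This is the same recursion as for the degrees seen by the lazy walk. -/
theorem gwLaw_matches_cons (x : Vertex) (k : ℕ) (l : List (Vertex × ℕ)) :
    gwLaw p {ω | Matches ((x, k) :: l) ω} = gwLaw p {ω | Matches l ω} * degreeWeight p x l k := by
  classical
  unfold degreeWeight
  cases hl : l.lookup x with
  | some k' =>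
    have hmem := lookup_mem hl
    by_cases hk : k' = k
    · subst hk
      simp only [if_true, mul_one]
      congr 1
      ext ω
      simp only [Matches, List.forall_mem_cons, Set.mem_ofPred_eq]
      exact ⟨fun h => h.2, fun h => ⟨h _ hmem, h⟩⟩
    · simp only [hk, if_false, mul_zero]
      have : {ω | Matches ((x, k) :: l) ω} = ∅ := by
        refine Set.eq_empty_of_forall_notMem fun ω hω => hk ?_
        have h1 := hω (x, k) (by simp)
        have h2 := hω (x, k') (List.mem_cons_of_mem _ hmem)
        exact h2.symm.trans h1
      rw [this, measure_empty]
  | none =>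
    have hx : ∀ e ∈ l, e.1 ≠ x := by
      rintro ⟨y, j⟩ he rfl
      rw [List.lookup_eq_none_iff] at hl
      simpa using hl _ he
    -- A label recorded with two different values receives the empty set, so inconsistent histories
    -- need no separate treatment.
    let T : List (Vertex × ℕ) → Vertex → Set ℕ := fun l v => {j | ∀ e ∈ l, e.1 = v → j = e.2}
    have hT : ∀ l : List (Vertex × ℕ), {ω : Env | Matches l ω} =
        Set.pi ((l.map Prod.fst).toFinset : Set Vertex) (T l) := by
      intro l
      ext ω
      simp only [Matches, T, Set.mem_ofPred_eq, Set.mem_pi]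
      constructor
      · rintro h v - e he rfl
        exact h e he
      · intro h e he
        exact h e.1 (by simpa using ⟨e.2, he⟩) e he rfl
    have hxn : x ∉ (l.map Prod.fst).toFinset := by
      simp only [List.mem_toFinset, List.mem_map, not_exists, not_and]
      exact hx
    rw [hT, hT, gwLaw, Measure.infinitePi_pi _ (fun _ _ => MeasurableSet.of_discrete),
      Measure.infinitePi_pi _ (fun _ _ => MeasurableSet.of_discrete), List.map_cons,
      List.toFinset_cons, Finset.prod_insert hxn, mul_comm]
    congr 1
    · refine Finset.prod_congr rfl fun v hv => ?_
      congr 1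
      ext j
      have hvx : x ≠ v := fun h => hxn (h ▸ hv)
      simp only [T, List.forall_mem_cons, Set.mem_ofPred_eq]
      exact ⟨fun h => h.2, fun h => ⟨fun h' => absurd h' hvx, h⟩⟩
    · rw [← PMF.toMeasure_apply_singleton p k (measurableSet_singleton k)]
      congr 1
      ext j
      simp only [T, List.forall_mem_cons, forall_const, Set.mem_ofPred_eq, Set.mem_singleton_iff]
      exact ⟨fun h => h.1, fun h => ⟨h, fun e he hex => absurd hex (hx e he)⟩⟩

/-- The positions of a trajectory before time `n`, the last one first. -/
def record (X : ℕ → Vertex) : ℕ → List Vertex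
  | 0 => []
  | n + 1 => X n :: record X n

theorem record_eq_iff (X Y : ℕ → Vertex) (n : ℕ) :
    record X n = record Y n ↔ ∀ i < n, X i = Y i := by
  induction n with
  | zero => simp [record]
  | succ n ih =>
    simp only [record, List.cons.injEq, ih, Nat.lt_succ_iff_lt_or_eq]
    exact ⟨fun h i hi => hi.elim (h.2 i) (fun e => e ▸ h.1),
      fun h => ⟨h n (Or.inr rfl), fun i hi => h i (Or.inl hi)⟩⟩

/-- The probability that the walk follows the given history, if the environment matches it. -/
def pathWeight (β : ℝ≥0) : Vertex → List (Vertex × ℕ) → ℝ≥0∞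
  | x, [] => if x = [] then 1 else 0
  | x', (x, k) :: l => pathWeight β x l * stepLaw β k x {x'}

theorem cyl_eq_record (n : ℕ) (Y : ℕ → Vertex) :
    cyl n Y = {X | X n = Y n ∧ record X n = record Y n} := by
  ext X
  simp only [cyl, Set.mem_ofPred_eq, record_eq_iff, Nat.le_iff_lt_or_eq]
  exact ⟨fun h => ⟨h n (Or.inr rfl), fun i hi => h i (Or.inl hi)⟩,
    fun h i hi => hi.elim (h.2 i) (fun e => e ▸ h.1)⟩

/-- The quenched probability is constant over the environments that match the history, so averaging
over trees only multiplies it by the probability of a match. -/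
theorem quenchedLaw_record {ω : Env} (x : Vertex) (l : List (Vertex × ℕ)) (hω : Matches l ω) :
    quenchedLaw β ω {X | X l.length = x ∧ record X l.length = l.map Prod.fst} =
      pathWeight β x l := by
  induction l generalizing x with
  | nil =>
    have h := quenchedLaw_cyl_zero β ω fun _ => x
    rw [cyl_eq_record] at h
    simp only [record] at h
    simp only [pathWeight, List.length_nil, record, List.map_nil, and_true] at h ⊢
    rw [h]
    by_cases hx : x = []
    · simp [hx]
    · simp [hx, Ne.symm hx]
  | cons e l ih =>
    obtain ⟨y, k⟩ := e
    rw [pathWeight, ← ih y fun e he => hω e (List.mem_cons_of_mem _ he)]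
    simp only [List.length_cons, record, List.map_cons, List.cons.injEq]
    by_cases hne : ∃ X0 : ℕ → Vertex, X0 l.length = y ∧ record X0 l.length = l.map Prod.fst
    · obtain ⟨X0, h1, h2⟩ := hne
      let X1 : ℕ → Vertex := fun i => if i ≤ l.length then X0 i else x
      have hX1 : ∀ i ≤ l.length, X1 i = X0 i := fun i hi => by simp [X1, hi]
      have hX1' : X1 (l.length + 1) = x := by simp [X1]
      have hrec : record X1 l.length = l.map Prod.fst := by
        rw [← h2, record_eq_iff]; exact fun i hi => hX1 i hi.le
      have h3 := quenchedLaw_cyl_succ β ω X1 l.length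
      rw [cyl_eq_record, cyl_eq_record] at h3
      simp only [record, hX1', hX1 _ le_rfl, h1, hrec, List.cons.injEq] at h3
      rw [h3, hω (y, k) (by simp)]
    · push Not at hne
      have e1 : {X : ℕ → Vertex | X l.length = y ∧ record X l.length = l.map Prod.fst} = ∅ :=
        Set.eq_empty_of_forall_notMem fun X hX => hne X hX.1 hX.2
      have e2 : {X : ℕ → Vertex | X (l.length + 1) = x ∧ X l.length = y ∧
          record X l.length = l.map Prod.fst} = ∅ :=
        Set.eq_empty_of_forall_notMem fun X hX => hne X hX.2.1 hX.2.2
      rw [e1, e2, measure_empty, zero_mul]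

/-- The history of a trajectory in a given environment. -/
def envHistory (z : Env × (ℕ → Vertex)) : ℕ → List (Vertex × ℕ)
  | 0 => []
  | n + 1 => (z.2 n, z.1 (z.2 n)) :: envHistory z n

theorem map_fst_envHistory (z : Env × (ℕ → Vertex)) (n : ℕ) :
    (envHistory z n).map Prod.fst = record z.2 n := by
  induction n with
  | zero => rfl
  | succ n ih => simp [envHistory, record, ih]

theorem envHistory_eq_iff (z : Env × (ℕ → Vertex)) (n : ℕ) (l : List (Vertex × ℕ)) :
    envHistory z n = l ↔ l.length = n ∧ Matches l z.1 ∧ record z.2 n = l.map Prod.fst := by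
  induction n generalizing l with
  | zero =>
    cases l <;> simp [envHistory, Matches, record]
  | succ n ih =>
    cases l with
    | nil => simp [envHistory]
    | cons e l =>
      obtain ⟨x, k⟩ := e
      simp only [envHistory, record, List.cons.injEq, Prod.mk.injEq, List.length_cons,
        Nat.add_right_cancel_iff, List.map_cons, ih, Matches, List.forall_mem_cons]
      constructor
      · rintro ⟨⟨rfl, h2⟩, h3, h4, h5⟩
        exact ⟨h3, ⟨h2, h4⟩, rfl, h5⟩
      · rintro ⟨h3, ⟨h2, h4⟩, rfl, h5⟩
        exact ⟨⟨rfl, h2⟩, h3, h4, h5⟩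

theorem setOf_envState_eq (n : ℕ) (x : Vertex) (l : List (Vertex × ℕ)) (hl : l.length = n) :
    {z : Env × (ℕ → Vertex) | (z.2 n, envHistory z n) = (x, l)} =
      {ω | Matches l ω} ×ˢ {X | X l.length = x ∧ record X l.length = l.map Prod.fst} := by
  ext z
  simp only [Prod.mk.injEq, envHistory_eq_iff, Set.mem_ofPred_eq, Set.mem_prod, hl, true_and]
  tauto

theorem measurableSet_record_eq (n : ℕ) (x : Vertex) (l : List Vertex) :
    MeasurableSet {X : ℕ → Vertex | X n = x ∧ record X n = l} := by
  have h1 : MeasurableSet {X : ℕ → Vertex | record X n = l} := by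
    by_cases hne : ∃ X0 : ℕ → Vertex, record X0 n = l
    · obtain ⟨X0, rfl⟩ := hne
      simp only [record_eq_iff, Set.ofPred_forall]
      exact MeasurableSet.iInter fun i => MeasurableSet.iInter fun _ =>
        (measurable_pi_apply i : Measurable fun X : ℕ → Vertex => X i) (measurableSet_singleton _)
    · push Not at hne
      rw [Set.eq_empty_of_forall_notMem (s := {X : ℕ → Vertex | record X n = l}) hne]
      exact MeasurableSet.empty
  exact MeasurableSet.inter
    ((measurable_pi_apply n : Measurable fun X : ℕ → Vertex => X n) (measurableSet_singleton x)) h1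

theorem averagedLaw_envState (n : ℕ) (x : Vertex) (l : List (Vertex × ℕ)) (hl : l.length = n) :
    averagedLaw p β {z | (z.2 n, envHistory z n) = (x, l)} =
      gwLaw p {ω | Matches l ω} * pathWeight β x l := by
  rw [setOf_envState_eq n x l hl, averagedLaw, Measure.compProd_apply_prod
    (measurableSet_matches l) (measurableSet_record_eq _ _ _), mul_comm,
    ← setLIntegral_const]
  exact setLIntegral_congr_fun (measurableSet_matches l) fun ω hω => quenchedLaw_record x l hω

theorem measurable_envState (n : ℕ) :
    Measurable fun z : Env × (ℕ → Vertex) => ((z.2 n, envHistory z n) : State) := by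
  refine measurable_to_countable' fun s => ?_
  obtain ⟨x, l⟩ := s
  by_cases hl : l.length = n
  · change MeasurableSet {z : Env × (ℕ → Vertex) | (z.2 n, envHistory z n) = (x, l)}
    rw [setOf_envState_eq n x l hl]
    exact (measurableSet_matches l).prod (measurableSet_record_eq _ _ _)
  · convert MeasurableSet.empty
    refine Set.eq_empty_of_forall_notMem fun z hz => hl ?_
    exact ((envHistory_eq_iff z n l).1 (congrArg Prod.snd hz)).1

theorem noiseLaw_lazyState (hp : p 0 = 0) (h : β ≤ β') (n : ℕ) (x : Vertex)
    (l : List (Vertex × ℕ)) (hl : l.length = n) :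
    noiseLaw p β {ξ | lazyState β β' ξ n = (x, l)} =
      gwLaw p {ω | Matches l ω} * pathWeight β' x l := by
  induction l generalizing n x with
  | nil =>
    subst hl
    rw [List.length_nil, noiseLaw_lazyState_zero]
    simp [Matches, pathWeight]
  | cons e l ih =>
    obtain ⟨y, k⟩ := e
    subst hl
    rw [List.length_cons, noiseLaw_lazyState_succ hp h, ih _ y rfl, gwLaw_matches_cons, pathWeight]
    ring

theorem length_history (ξ : ℕ → Mark) (n : ℕ) : (lazyState β β' ξ n).2.length = n := by
  induction n with
  | zero => rfl
  | succ n ih => simp [lazyState_succ, next, ih]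

/-- The walk in a given environment and the walk that discovers its environment have histories with
the same law. -/
theorem map_envState_averagedLaw (hp : p 0 = 0) (h : β ≤ β') (n : ℕ) :
    (averagedLaw p β').map (fun z => ((z.2 n, envHistory z n) : State)) =
      (noiseLaw p β).map fun ξ => lazyState β β' ξ n := by
  refine Measure.ext_of_singleton fun s => ?_
  obtain ⟨x, l⟩ := s
  rw [Measure.map_apply (measurable_envState n) (measurableSet_singleton _),
    Measure.map_apply (measurable_lazyState n) (measurableSet_singleton _)]
  by_cases hl : l.length = n
  · exact (averagedLaw_envState n x l hl).trans (noiseLaw_lazyState hp h n x l hl).symm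
  · have h1 : (fun z : Env × (ℕ → Vertex) => ((z.2 n, envHistory z n) : State)) ⁻¹' {(x, l)} = ∅ :=
      Set.eq_empty_of_forall_notMem fun z hz => hl
        ((envHistory_eq_iff z n l).1 (congrArg Prod.snd hz)).1
    have h2 : (fun ξ => lazyState β β' ξ n) ⁻¹' {(x, l)} = ∅ :=
      Set.eq_empty_of_forall_notMem fun ξ hξ => hl (by
        rw [← length_history (β := β) (β' := β') ξ n, show lazyState β β' ξ n = (x, l) from hξ])
    rw [h1, h2, measure_empty, measure_empty]

theorem map_fst_history (ξ : ℕ → Mark) (n : ℕ) :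
    (lazyState β β' ξ n).2.map Prod.fst = record (fun i => (lazyState β β' ξ i).1) n := by
  induction n with
  | zero => rfl
  | succ n ih => simp [lazyState_succ, next, record, ih]

/-- The walk that discovers its environment has the averaged law of the biased walk. -/
theorem map_snd_averagedLaw (hp : p 0 = 0) (h : β ≤ β') :
    (averagedLaw p β').map Prod.snd =
      (noiseLaw p β).map fun ξ n => (lazyState β β' ξ n).1 := by
  have hmeas : Measurable fun (ξ : ℕ → Mark) n => (lazyState β β' ξ n).1 :=
    measurable_pi_lambda _ fun n => measurable_fst.comp (measurable_lazyState n)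
  have := Measure.isProbabilityMeasure_map (μ := averagedLaw p β') measurable_snd.aemeasurable
  have := Measure.isProbabilityMeasure_map (μ := noiseLaw p β) hmeas.aemeasurable
  refine ext_of_generate_finite _
    (generateFrom_measurableCylinders (α := fun _ : ℕ => Vertex)).symm
    (isPiSystem_measurableCylinders (α := fun _ : ℕ => Vertex)) ?_ (by simp)
  intro s hs
  have hsm := MeasurableSet.of_mem_measurableCylinders hs
  obtain ⟨n, S, -, rfl⟩ : ∃ (n : ℕ) (S : Set ((i : Finset.Iic n) → Vertex)),
      MeasurableSet S ∧ s = cylinder (Finset.Iic n) S := by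
    simpa [measurableCylinders_nat] using hs
  let C : Set (ℕ → Vertex) := cylinder (α := fun _ => Vertex) (Finset.Iic n) S
  -- The trajectory up to time `n` can be read off the state at time `n`, so equality of the
  -- one-time laws of states gives equality on cylinders.
  let B : Set State := {s | ∃ Y ∈ C, record Y (n + 1) = s.1 :: s.2.map Prod.fst}
  have hB : ∀ X : ℕ → Vertex, X ∈ C ↔ ∃ Y ∈ C, record Y (n + 1) = record X (n + 1) := by
    refine fun X => ⟨fun hX => ⟨X, hX, rfl⟩, ?_⟩
    rintro ⟨Y, hY, hYX⟩
    rw [record_eq_iff] at hYX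
    have : (Finset.Iic n).restrict X = (Finset.Iic n).restrict Y := by
      funext ⟨i, hi⟩
      exact (hYX i (Nat.lt_succ_of_le (Finset.mem_Iic.1 hi))).symm
    change (Finset.Iic n).restrict X ∈ S
    rw [this]
    exact hY
  rw [Measure.map_apply measurable_snd hsm, Measure.map_apply hmeas hsm]
  have h1 : (Prod.snd : Env × (ℕ → Vertex) → _) ⁻¹' C =
      (fun z : Env × (ℕ → Vertex) => ((z.2 n, envHistory z n) : State)) ⁻¹' B := by
    ext z
    rw [Set.mem_preimage, hB]
    simp only [B, Set.mem_preimage, Set.mem_ofPred_eq, map_fst_envHistory, record]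
  have h2 : (fun (ξ : ℕ → Mark) n => (lazyState β β' ξ n).1) ⁻¹' C =
      (fun ξ => lazyState β β' ξ n) ⁻¹' B := by
    ext ξ
    rw [Set.mem_preimage, hB]
    simp only [B, Set.mem_preimage, Set.mem_ofPred_eq, map_fst_history, record]
  rw [h1, h2, ← Measure.map_apply (measurable_envState n) (MeasurableSet.of_discrete),
    ← Measure.map_apply (measurable_lazyState n) (MeasurableSet.of_discrete),
    map_envState_averagedLaw hp h]

theorem isSpeed_of_noiseLaw (hp : p 0 = 0) (h : β ≤ β') {v : ℝ}
    (hv : ∀ᵐ ξ ∂noiseLaw p β,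
      Tendsto (fun n : ℕ => (depth β β' ξ n : ℝ) / n) atTop (𝓝 v)) : IsSpeed p β' v := by
  have hmeas : Measurable fun (ξ : ℕ → Mark) n => (lazyState β β' ξ n).1 :=
    measurable_pi_lambda _ fun n => measurable_fst.comp (measurable_lazyState n)
  have hm : MeasurableSet {X : ℕ → Vertex |
      Tendsto (fun n : ℕ => ((X n).length : ℝ) / n) atTop (𝓝 v)} :=
    measurableSet_tendsto _ fun n =>
      (measurable_of_countable fun x : Vertex => (x.length : ℝ) / n).comp (measurable_pi_apply n)
  have h1 : ∀ᵐ X ∂(averagedLaw p β').map Prod.snd,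
      Tendsto (fun n : ℕ => ((X n).length : ℝ) / n) atTop (𝓝 v) := by
    rw [map_snd_averagedLaw hp h]
    exact (ae_map_iff hmeas.aemeasurable hm).2 hv
  exact ae_of_ae_map measurable_snd.aemeasurable h1

end Law

/-! ### Pathwise comparison of the two coupled walks -/

section Coupling

variable {β β' : ℝ≥0}

/-- At time `n` the mark sends the two walks into different directions at a vertex with the number
of children discovered at time `j`. -/
def Discrepancy (β β' : ℝ≥0) (ξ : ℕ → Mark) (j n : ℕ) : Prop :=
  (ξ n).1.1 = true ∧ backThreshold β β' (max 1 (ξ j).2) ≤ (ξ n).1.2.1 ∧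
    (ξ n).1.2.1 < backThreshold β β (max 1 (ξ j).2)

open Classical in
/-- A bound for the distance that the faster walk may lose up to time `t`. -/
def loss (β β' : ℝ≥0) (t : ℕ) (ξ : ℕ → Mark) : ℕ :=
  ∑ n ∈ Finset.range t, ∑ j ∈ Finset.range t,
    if Discrepancy β β' ξ j n then 2 * (backs ξ t - 2) else 0

theorem backThreshold_anti (h : β ≤ β') (k : ℕ) :
    backThreshold β β' k ≤ backThreshold β β k := by
  have : (β : ℝ) ≤ β' := by exact_mod_cast h
  unfold backThreshold
  gcongr

theorem move_eq_or (h : β ≤ β') {k : ℕ} (hk : k ≠ 0) (m : Move) (x : Vertex) :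
    move β β' k m x = move β β k m x ∨
      ((move β β' k m x).length = (move β β k m x).length + 2 ∧ m.1 = true ∧
        backThreshold β β' k ≤ m.2.1 ∧ m.2.1 < backThreshold β β k) := by
  have := backThreshold_anti h k
  cases x with
  | nil => left; rfl
  | cons a y =>
    simp only [move, hk, false_or]
    by_cases h1 : m.1 = true ∧ m.2.1 < backThreshold β β k
    · by_cases h2 : m.1 = true ∧ m.2.1 < backThreshold β β' k
      · left; rw [if_pos h1, if_pos h2]
      · right
        rw [if_pos h1, if_neg h2]
        refine ⟨by simp, h1.1, not_lt.1 fun h3 => h2 ⟨h1.1, h3⟩, h1.2⟩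
    · have h2 : ¬ (m.1 = true ∧ m.2.1 < backThreshold β β' k) := fun h2 =>
        h1 ⟨h2.1, h2.2.trans_le this⟩
      left; rw [if_neg h1, if_neg h2]

/-- The walks agree until a discrepancy makes the walk with the larger bias win two units of
distance, and it loses at most two units whenever a step back is allowed afterwards. -/
theorem lazyState_eq_or (h : β ≤ β') (ξ : ℕ → Mark) (t : ℕ) :
    lazyState β β' ξ t = lazyState β β ξ t ∨
      ∃ n < t, ∃ j ≤ n, Discrepancy β β' ξ j n ∧
        depth β β ξ t + 2 + 2 * backs ξ (n + 1) ≤ depth β β' ξ t + 2 * backs ξ t := by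
  induction t with
  | zero => left; rfl
  | succ t ih =>
    rcases ih with heq | ⟨n, hn, j, hj, hd, hle⟩
    · obtain ⟨j, hj, hdeg⟩ := exists_degree_eq (β := β) (β' := β) ξ t
      have hk := degree_ne_zero (β := β) (β' := β) ξ t
      rcases move_eq_or h hk (ξ t).1 (lazyState β β ξ t).1 with hm | ⟨hl, hb, h1, h2⟩
      · left
        rw [lazyState_succ, lazyState_succ, heq, next, next, hm]
      · right
        rw [hdeg] at h1 h2
        refine ⟨t, by omega, j, hj, ⟨hb, h1, h2⟩, ?_⟩
        simp only [depth, lazyState_succ, next, heq]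
        omega
    · right
      refine ⟨n, by omega, j, hj, hd, ?_⟩
      rw [backs_succ ξ t]
      -- After the separation the walks may see different degrees. Still, without a flag both rise
      -- by one, and with a flag the difference of depths falls by at most two.
      cases hb : (ξ t).1.1
      · rw [depth_succ_of_not_back ξ hb, depth_succ_of_not_back ξ hb]
        simp only [Bool.false_eq_true, if_false]
        omega
      · have h1 := depth_succ_le (β := β) (β' := β) ξ t
        have h2 := le_depth_succ (β := β) (β' := β') ξ t
        simp only [if_true]
        omega

theorem depth_le_add_loss (h : β ≤ β') (ξ : ℕ → Mark) (t : ℕ) :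
    depth β β ξ t ≤ depth β β' ξ t + loss β β' t ξ := by
  classical
  rcases lazyState_eq_or h ξ t with heq | ⟨n, hn, j, hj, hd, hle⟩
  · simp [depth, heq]
  · have h1 : 2 * (backs ξ t - 2) ≤ loss β β' t ξ := by
      unfold loss
      refine le_trans ?_ (Finset.single_le_sum (fun _ _ => Nat.zero_le _)
        (Finset.mem_range.2 hn))
      refine le_trans ?_ (Finset.single_le_sum (fun _ _ => Nat.zero_le _)
        (Finset.mem_range.2 (hj.trans_lt hn)))
      rw [if_pos hd]
    -- The separating mark is itself a flag, so at most `backs ξ t - 1` flags follow it; the two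
    -- units won reduce the loss to `2 * (backs ξ t - 2)`.
    have h2 : 1 ≤ backs ξ (n + 1) := by rw [backs_succ, if_pos hd.1]; omega
    omega

/-- The first four steps form a block with a single step back, at which the walks separate. -/
def GainBlock (β β' : ℝ≥0) (ξ : ℕ → Mark) : Prop :=
  (ξ 0).1.1 = false ∧ Discrepancy β β' ξ 1 1 ∧ (ξ 2).1.1 = false ∧ (ξ 3).1.1 = false

theorem GainBlock.isBlock {ξ : ℕ → Mark} (hg : GainBlock β β' ξ) : IsBlock ξ 4 := by
  obtain ⟨h0, ⟨h1, -⟩, h2, h3⟩ := hg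
  have e1 : height ξ 1 = 1 := by rw [height_succ, h0]; simp
  have e2 : height ξ 2 = 0 := by rw [height_succ, h1, e1]; simp
  have e3 : height ξ 3 = 1 := by rw [height_succ, h2, e2]; simp
  have e4 : height ξ 4 = 2 := by rw [height_succ, h3, e3]; simp
  refine ⟨by omega, fun j hj => ?_, fun j hj => ?_, fun t' h1' h2' hr => ?_⟩
  · interval_cases j <;> simp [e1, e2, e3, e4]
  · interval_cases j <;> simp [e1, e2, e3, e4]
  · interval_cases t'
    · exact ⟨2, by omega, by omega, by omega⟩
    · have := hr 1 (by omega); omega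
    · have := hr 1 (by omega); omega

/-- The vertex at time one is new, so its degree comes from mark one, whence the indices `1 1` in
the discrepancy. There one walk returns to the root while the other moves on, and no flag follows.
-/
theorem GainBlock.depth_eq {ξ : ℕ → Mark} (hg : GainBlock β β' ξ) :
    depth β β' ξ 4 = depth β β ξ 4 + 2 := by
  obtain ⟨h0, ⟨h1, h1', h1''⟩, h2, h3⟩ := hg
  rw [depth_succ_of_not_back ξ h3, depth_succ_of_not_back ξ h3, depth_succ_of_not_back ξ h2,
    depth_succ_of_not_back ξ h2]
  -- At the root the thresholds play no role, so the state at time one does not depend on the bias.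
  have hd : ∀ b : ℝ≥0, lazyState β b ξ 1 =
      ([⌊(ξ 0).1.2.2 * (max 1 (ξ 0).2 : ℕ)⌋₊], [([], max 1 (ξ 0).2)]) := fun b => by
    simp [lazyState, next, degree, move]
  have hne : ∀ i : ℕ, (([i] : Vertex) == []) = false := fun i => rfl
  simp only [depth, lazyState_succ (n := 1), hd, next, degree, List.lookup_cons, List.lookup_nil,
    hne, Option.getD_none, move, h1, true_and]
  rw [if_neg (by simp [not_lt.2 h1']), if_pos (Or.inr h1'')]
  rfl

end Coupling

/-! ### The probability that the walks separate -/

section Separation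

variable (p : PMF ℕ) {β β' : ℝ≥0}

/-- The probability that the mark separates the walks at a vertex with `max 1 k` children, given
that a step back is allowed. -/
def sepProb (β β' : ℝ≥0) (k : ℕ) : ℝ≥0∞ :=
  unitLaw {e | backThreshold β β' (max 1 k) ≤ e ∧ e < backThreshold β β (max 1 k)}

/-- The probability that the walks separate at a new vertex, given that a step back is allowed. -/
def meanSepProb (p : PMF ℕ) (β β' : ℝ≥0) : ℝ≥0∞ := ∑' k, p k * sepProb β β' k

theorem measurableSet_sep (k : ℕ) : MeasurableSet
    {e : ℝ | backThreshold β β' (max 1 k) ≤ e ∧ e < backThreshold β β (max 1 k)} :=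
  (measurableSet_le measurable_const measurable_id).inter
    (measurableSet_lt measurable_id measurable_const)

theorem meanSepProb_ne_top : meanSepProb p β β' ≠ ∞ := by
  refine ne_top_of_le_ne_top (b := ∑' k, p k) (by simp [p.tsum_coe]) ?_
  refine ENNReal.tsum_le_tsum fun k => ?_
  calc p k * sepProb β β' k ≤ p k * 1 := by gcongr; exact prob_le_one
    _ = p k := mul_one _

/-- At every degree the two thresholds bound a nondegenerate interval inside the unit interval, so
any degree in the support contributes. -/
theorem meanSepProb_ne_zero (h : β < β') : meanSepProb p β β' ≠ 0 := by
  obtain ⟨k, hk⟩ := p.support_nonempty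
  rw [PMF.mem_support_iff] at hk
  have h1 : sepProb β β' k ≠ 0 := by
    have hK : (0 : ℝ) < (max 1 k : ℕ) := by
      exact_mod_cast lt_of_lt_of_le one_pos (le_max_left 1 k)
    have hlt : (β : ℝ) < β' := by exact_mod_cast h
    have hβ0 : (0 : ℝ) ≤ β := β.2
    have h2 : backThreshold β β' (max 1 k) < backThreshold β β (max 1 k) := by
      unfold backThreshold
      gcongr
    have h3 : 0 ≤ backThreshold β β' (max 1 k) := by unfold backThreshold; positivity
    have h4 : backThreshold β β (max 1 k) ≤ 1 := by
      have := threshold_le_one (le_refl β) (k := max 1 k) (by omega)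
      have h5 : (((1 + β) / (1 + β * (max 1 k : ℕ)) : ℝ≥0) : ℝ) ≤ 1 := by exact_mod_cast this
      simpa [backThreshold] using h5
    have h5 : {e : ℝ | backThreshold β β' (max 1 k) ≤ e ∧ e < backThreshold β β (max 1 k)} ∩
        Set.Ico 0 1 = Set.Ico (backThreshold β β' (max 1 k)) (backThreshold β β (max 1 k)) := by
      ext e
      simp only [Set.mem_inter_iff, Set.mem_ofPred_eq, Set.mem_Ico]
      constructor
      · exact fun h => h.1
      · exact fun h => ⟨h, h3.trans h.1, h.2.trans_le h4⟩
    rw [sepProb, unitLaw, Measure.restrict_apply (measurableSet_sep k), h5, Real.volume_Ico,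
      ne_eq, ENNReal.ofReal_eq_zero, not_le]
    linarith
  intro h0
  have := ENNReal.tsum_eq_zero.1 h0 k
  exact (mul_ne_zero hk h1) this

open Classical in
/-- The indicator that a move separates the walks at a vertex with `max 1 k` children. -/
def sepIndicator (β β' : ℝ≥0) (k : ℕ) (m : Move) : ℝ≥0∞ :=
  if m.1 = true ∧ backThreshold β β' (max 1 k) ≤ m.2.1 ∧
    m.2.1 < backThreshold β β (max 1 k) then 1 else 0

theorem measurable_sepIndicator (k : ℕ) : Measurable (sepIndicator β β' k) := by
  refine Measurable.ite ?_ measurable_const measurable_const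
  exact (measurable_fst (measurableSet_singleton true)).inter
    (measurable_snd.fst (measurableSet_sep k))

theorem lintegral_flag_mul_sepIndicator (g : Bool → ℝ≥0∞) (k : ℕ) :
    ∫⁻ m, g m.1 * sepIndicator β β' k m ∂moveLaw β =
      ((1 / (1 + β) : ℝ≥0) : ℝ≥0∞) * g true * sepProb β β' k := by
  classical
  have h1 : ∀ m : Move, g m.1 * sepIndicator β β' k m = (if m.1 then g true else 0) *
      {e : ℝ | backThreshold β β' (max 1 k) ≤ e ∧
        e < backThreshold β β (max 1 k)}.indicator 1 m.2.1 := by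
    rintro ⟨b, e, c⟩
    cases b <;> simp [sepIndicator, Set.indicator]
  have hm : Measurable ({e : ℝ | backThreshold β β' (max 1 k) ≤ e ∧
        e < backThreshold β β (max 1 k)}.indicator (1 : ℝ → ℝ≥0∞)) :=
    measurable_one.indicator (measurableSet_sep k)
  simp_rw [h1]
  rw [moveLaw, lintegral_prod_mul (f := fun b : Bool => if b then g true else 0)
    (g := fun z : ℝ × ℝ => {e : ℝ | backThreshold β β' (max 1 k) ≤ e ∧
        e < backThreshold β β (max 1 k)}.indicator 1 z.1)
    (measurable_of_countable _).aemeasurable (hm.comp measurable_fst).aemeasurable,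
    lintegral_flagLaw]
  have h2 : MeasurePreserving (Prod.fst : ℝ × ℝ → ℝ) (unitLaw.prod unitLaw) unitLaw :=
    measurePreserving_fst
  rw [h2.lintegral_comp hm, lintegral_indicator_one (measurableSet_sep k)]
  simp [sepProb]

theorem lintegral_flag (g : Bool → ℝ≥0∞) :
    ∫⁻ m, g m.1 ∂moveLaw β = ∫⁻ b, g b ∂flagLaw β := by
  have h : MeasurePreserving (Prod.fst : Move → Bool) (moveLaw β) (flagLaw β) :=
    measurePreserving_fst
  exact h.lintegral_comp (measurable_of_countable g)

theorem half_mul_le : ((1 / (1 + β) : ℝ≥0) : ℝ≥0∞) * backWeight β true =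
    ((3 / 2 : ℝ≥0) : ℝ≥0∞) * ((1 / 3 : ℝ≥0) : ℝ≥0∞) := by
  simp only [backWeight, if_true]
  rw [← ENNReal.coe_mul, ← ENNReal.coe_mul]
  congr 1
  field_simp

theorem measurableSet_discrepancy (j n : ℕ) : MeasurableSet {ξ | Discrepancy β β' ξ j n} := by
  have hk : ∀ b : ℝ≥0, Measurable fun ξ : ℕ → Mark => backThreshold β b (max 1 (ξ j).2) := fun b =>
    (measurable_of_countable fun d : ℕ => backThreshold β b (max 1 d)).comp
      (measurable_pi_apply j).snd
  have he : Measurable fun ξ : ℕ → Mark => (ξ n).1.2.1 := (measurable_pi_apply n).fst.snd.fst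
  exact (measurable_back n (measurableSet_singleton true)).inter
    ((measurableSet_le (hk β') he).inter (measurableSet_lt he (hk β)))

open Classical in
-- The discrepancy forces a flag at time `n`, whose weighted mass is `1 / 2 = (3 / 2) * (1 / 3)`;
-- the separating mark then contributes `sepProb`, averaged over the degree at time `j`. Every other
-- time contributes at most `3 / 2`.
theorem lintegral_discrepancy_le (t : ℕ) {j n : ℕ} (hj : j < t) (hn : n < t) :
    ∫⁻ ξ, (if Discrepancy β β' ξ j n then 1 else 0) *
        ∏ i ∈ Finset.range t, backWeight β (ξ i).1.1 ∂noiseLaw p β ≤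
      meanSepProb p β β' * (((1 / 3 : ℝ≥0) : ℝ≥0∞) * ((3 / 2 : ℝ≥0) : ℝ≥0∞) ^ t) := by
  -- Splitting over the degree `k` at time `j` turns the integrand into a sum of products over
  -- independent marks. Keeping the move factors `a` apart from the degree factors `b` covers `j =
  -- n` as well.
  let a : ℕ → ℕ → Move → ℝ≥0∞ := fun k i m =>
    backWeight β m.1 * if i = n then sepIndicator β β' k m else 1
  let b : ℕ → ℕ → ℕ → ℝ≥0∞ := fun k i d => if i = j then (if d = k then 1 else 0) else 1
  have ha : ∀ k i, Measurable (a k i) := fun k i => by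
    refine ((measurable_of_countable (backWeight β)).comp measurable_fst).mul ?_
    split_ifs
    · exact measurable_sepIndicator k
    · exact measurable_const
  have hb : ∀ k i, Measurable (b k i) := fun k i => measurable_of_countable _
  have hab : ∀ k i, Measurable fun m : Mark => a k i m.1 * b k i m.2 := fun k i =>
    ((ha k i).comp measurable_fst).mul ((hb k i).comp measurable_snd)
  have hsum : ∀ ξ : ℕ → Mark, (if Discrepancy β β' ξ j n then 1 else 0) *
      ∏ i ∈ Finset.range t, backWeight β (ξ i).1.1 =
      ∑' k, ∏ i ∈ Finset.range t, (a k i (ξ i).1 * b k i (ξ i).2) := by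
    intro ξ
    have hprod : ∀ k, ∏ i ∈ Finset.range t, (a k i (ξ i).1 * b k i (ξ i).2) =
        (∏ i ∈ Finset.range t, backWeight β (ξ i).1.1) * sepIndicator β β' k (ξ n).1 *
          if (ξ j).2 = k then 1 else 0 := by
      intro k
      simp only [a, b, Finset.prod_mul_distrib]
      rw [Finset.prod_ite_eq' (Finset.range t) n, if_pos (Finset.mem_range.2 hn),
        Finset.prod_ite_eq' (Finset.range t) j, if_pos (Finset.mem_range.2 hj)]
    simp_rw [hprod]
    rw [tsum_eq_single (ξ j).2 fun k hk => by simp [Ne.symm hk], mul_comm]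
    simp only [sepIndicator, Discrepancy, if_true, mul_one]
    congr
  have hint : ∀ k i, ∫⁻ m, a k i m.1 * b k i m.2 ∂markLaw p β ≤
      ((3 / 2 : ℝ≥0) : ℝ≥0∞) *
        (if i = n then ((1 / 3 : ℝ≥0) : ℝ≥0∞) * sepProb β β' k else 1) *
        (if i = j then p k else 1) := by
    intro k i
    rw [markLaw, lintegral_prod_mul (ha k i).aemeasurable (hb k i).aemeasurable]
    refine mul_le_mul' ?_ ?_
    · by_cases hi : i = n
      · simp only [a, hi, if_true]
        rw [lintegral_flag_mul_sepIndicator, half_mul_le, mul_assoc]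
      · simp only [a, hi, if_false, mul_one]
        rw [lintegral_flag]
        exact lintegral_backWeight_le β
    · by_cases hi : i = j
      · simp only [b, hi, if_true]
        rw [← PMF.toMeasure_apply_singleton p k (measurableSet_singleton k),
          ← lintegral_indicator_one (measurableSet_singleton k)]
        exact le_of_eq (lintegral_congr fun d => by simp [Set.indicator])
      · simp [b, hi]
  simp_rw [hsum]
  have hmeas : ∀ k, AEMeasurable (fun ξ : ℕ → Mark =>
      ∏ i ∈ Finset.range t, (a k i (ξ i).1 * b k i (ξ i).2)) (noiseLaw p β) := fun k =>
    (Finset.measurable_prod _ fun i _ => (hab k i).comp (measurable_pi_apply i)).aemeasurable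
  rw [lintegral_tsum hmeas, meanSepProb, ← ENNReal.tsum_mul_right]
  refine ENNReal.tsum_le_tsum fun k => ?_
  rw [lintegral_prod_noiseLaw p β (fun i m => a k i m.1 * b k i m.2) (hab k)]
  refine (Finset.prod_le_prod' fun i _ => hint k i).trans (le_of_eq ?_)
  rw [Finset.prod_mul_distrib, Finset.prod_mul_distrib, Finset.prod_ite_eq' (Finset.range t) n,
    if_pos (Finset.mem_range.2 hn), Finset.prod_ite_eq' (Finset.range t) j,
    if_pos (Finset.mem_range.2 hj), Finset.prod_const, Finset.card_range]
  ring

theorem noiseLaw_gainBlock : noiseLaw p β {ξ | GainBlock β β' ξ} =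
    ((β / (1 + β) : ℝ≥0) : ℝ≥0∞) ^ 3 *
      (((1 / (1 + β) : ℝ≥0) : ℝ≥0∞) * meanSepProb p β β') := by
  classical
  have hE := measurable_sepIndicator (β := β) (β' := β')
  let S : Set Mark := {m | sepIndicator β β' m.2 m.1 = 1}
  have hsep : Measurable fun m : Mark => sepIndicator β β' m.2 m.1 :=
    measurable_from_prod_countable_left fun k => hE k
  have hS : MeasurableSet S := hsep (measurableSet_singleton 1)
  let F : Set Mark := {m | m.1.1 = false}
  have hF : MeasurableSet F :=
    (measurable_fst.fst : Measurable fun m : Mark => m.1.1) (measurableSet_singleton false)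
  have hFm : markLaw p β F = ((β / (1 + β) : ℝ≥0) : ℝ≥0∞) := by
    have := lintegral_markLaw_flag p β (({false} : Set Bool).indicator 1)
    rw [lintegral_indicator_one (measurableSet_singleton false)] at this
    rw [← lintegral_indicator_one hF]
    refine Eq.trans ?_ (this.trans (by simp [flagLaw]))
    exact lintegral_congr fun m => by simp [F, Set.indicator]
  have hSm : markLaw p β S = ((1 / (1 + β) : ℝ≥0) : ℝ≥0∞) * meanSepProb p β β' := by
    have h1 : markLaw p β S = ∫⁻ m, sepIndicator β β' m.2 m.1 ∂markLaw p β := by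
      rw [← lintegral_indicator_one hS]
      refine lintegral_congr fun m => ?_
      by_cases hm : m ∈ S
      · rw [Set.indicator_of_mem hm]; exact (show _ = _ from hm).symm
      · rw [Set.indicator_of_notMem hm]
        simp only [S, sepIndicator, Set.mem_ofPred_eq] at hm ⊢
        split_ifs at hm ⊢
        · simp at hm
        · rfl
    rw [h1, markLaw, lintegral_prod_symm' _ hsep, lintegral_countable', meanSepProb,
      ← ENNReal.tsum_mul_left]
    refine tsum_congr fun k => ?_
    have h2 := lintegral_flag_mul_sepIndicator (β := β) (β' := β') (fun _ => 1) k
    simp only [one_mul, mul_one] at h2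
    rw [h2, PMF.toMeasure_apply_singleton _ _ (measurableSet_singleton k)]
    ring
  have hset : {ξ | GainBlock β β' ξ} =
      Set.pi (Finset.range 4 : Set ℕ) fun i => if i = 1 then S else F := by
    ext ξ
    simp only [GainBlock, Discrepancy, Set.mem_ofPred_eq, Set.mem_pi, Finset.coe_range,
      Set.mem_Iio]
    have hmem : ∀ m : Mark, m ∈ S ↔ m.1.1 = true ∧ backThreshold β β' (max 1 m.2) ≤ m.1.2.1 ∧
        m.1.2.1 < backThreshold β β (max 1 m.2) := fun m => by
      simp only [S, sepIndicator, Set.mem_ofPred_eq]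
      split_ifs with hc <;> simp [hc]
    constructor
    · rintro ⟨h0, h1, h2, h3⟩ i hi
      interval_cases i
      · simpa [F] using h0
      · simpa [hmem] using h1
      · simpa [F] using h2
      · simpa [F] using h3
    · intro h
      refine ⟨by simpa [F] using h 0 (by omega), by simpa [hmem] using h 1 (by omega),
        by simpa [F] using h 2 (by omega), by simpa [F] using h 3 (by omega)⟩
  rw [hset, noiseLaw, Measure.infinitePi_pi _ fun i _ => by split_ifs <;> assumption]
  have h4 : ∏ i ∈ Finset.range 4, markLaw p β (if i = 1 then S else F) =
      markLaw p β F ^ 3 * markLaw p β S := by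
    simp only [Finset.prod_range_succ, Finset.prod_range_zero]
    simp
    ring
  rw [h4, hFm, hSm]

end Separation

/-! ### Expected loss against expected gain, and monotonicity -/

section Monotonicity

variable (p : PMF ℕ) {β β' : ℝ≥0}

theorem pow_three_le_two_pow {t : ℕ} (ht : 10 ≤ t) : t ^ 3 ≤ 2 ^ t := by
  induction t, ht using Nat.le_induction with
  | base => norm_num
  | succ t ht ih =>
    rw [pow_succ 2]
    have h1 : 3 * t ^ 2 + 3 * t + 1 ≤ t ^ 3 := by nlinarith [Nat.mul_le_mul ht ht]
    calc (t + 1) ^ 3 = t ^ 3 + (3 * t ^ 2 + 3 * t + 1) := by ring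
      _ ≤ 2 ^ t * 2 := by omega

/-- A bound for the normalized expected loss in blocks of length `t`. -/
def lossBound (t : ℕ) : ℝ≥0 :=
  if t < 11 then 2 / 3 * (t - 2 : ℕ) * t ^ 2 * (3 / 2) ^ t * (1 / 359) ^ 2 else 1601 * (3 / 7) ^ t

theorem two_div_le_inv (hβ : 717 ≤ β) : 2 / (1 + β) ≤ 1 / 359 := by
  have : (717 : ℝ) ≤ β := by exact_mod_cast hβ
  rw [div_le_div_iff₀ (by positivity) (by norm_num), ← NNReal.coe_le_coe]
  push_cast
  linarith

/-- For short blocks the requirement of three flags leaves the exponent two. For long ones the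
polynomial is at most `2 ^ t`, which leaves a geometric sequence with ratio `2 * (3 / 2) * (1 / 7) =
3 / 7`. -/
theorem le_lossBound (hβ : 717 ≤ β) (t : ℕ) :
    2 / 3 * (t - 2 : ℕ) * t ^ 2 * (3 / 2) ^ t * (2 / (1 + β)) ^ (max 3 ((t + 1) / 3) - 1) ≤
      lossBound t := by
  unfold lossBound
  split_ifs with ht
  · refine mul_le_mul_right ?_ _
    calc (2 / (1 + β)) ^ (max 3 ((t + 1) / 3) - 1) ≤ (1 / 359) ^ (max 3 ((t + 1) / 3) - 1) := by
          exact pow_le_pow_left₀ zero_le (two_div_le_inv hβ) _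
      _ ≤ (1 / 359) ^ 2 := by
          refine pow_le_pow_of_le_one (by norm_num) ?_ (by omega)
          rw [div_le_one (by norm_num)]; norm_num
  · have h1 : ((t - 2 : ℕ) : ℝ≥0) * t ^ 2 ≤ 2 ^ t := by
      have : (t - 2) * t ^ 2 ≤ 2 ^ t := by
        refine le_trans ?_ (pow_three_le_two_pow (t := t) (by omega))
        rw [pow_succ' t 2]
        exact Nat.mul_le_mul_right _ (by omega)
      exact_mod_cast this
    have h2 : (2 / (1 + β)) ^ (max 3 ((t + 1) / 3) - 1) ≤ 2401 * (1 / 7 : ℝ≥0) ^ t := by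
      calc (2 / (1 + β)) ^ (max 3 ((t + 1) / 3) - 1)
          ≤ ((1 / 7) ^ 3) ^ (max 3 ((t + 1) / 3) - 1) := by gcongr; exact two_div_le hβ
        _ = (1 / 7 : ℝ≥0) ^ (3 * (max 3 ((t + 1) / 3) - 1)) := (pow_mul _ _ _).symm
        -- Rounding costs at most one in `3 * ((t + 1) / 3) ≥ t - 1`, and the factor split off costs
        -- three more.
        _ ≤ (1 / 7 : ℝ≥0) ^ (t - 4) := by
            refine pow_le_pow_of_le_one (by norm_num) ?_ (by omega)
            rw [div_le_one (by norm_num)]; norm_num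
        _ = 2401 * (1 / 7 : ℝ≥0) ^ t := by
            obtain ⟨s, rfl⟩ := Nat.exists_eq_add_of_le' (show 4 ≤ t by omega)
            rw [Nat.add_sub_cancel, pow_add]
            norm_num
            ring
    calc 2 / 3 * (t - 2 : ℕ) * t ^ 2 * (3 / 2) ^ t * (2 / (1 + β)) ^ (max 3 ((t + 1) / 3) - 1)
        = 2 / 3 * (((t - 2 : ℕ) : ℝ≥0) * t ^ 2) * (3 / 2) ^ t *
            (2 / (1 + β)) ^ (max 3 ((t + 1) / 3) - 1) := by ring
      _ ≤ 2 / 3 * 2 ^ t * (3 / 2) ^ t * (2401 * (1 / 7 : ℝ≥0) ^ t) := by gcongr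
      _ = 4802 / 3 * (2 * (3 / 2) * (1 / 7)) ^ t := by
          rw [mul_pow, mul_pow]; field_simp; ring
      _ = 4802 / 3 * (3 / 7) ^ t := by congr 2; field_simp
      _ ≤ 1601 * (3 / 7) ^ t := by
          gcongr
          rw [div_le_iff₀ (by norm_num)]; norm_num

/-- Numerically the terms below `11` sum to about `0.44` and the geometric tail to about `0.25`. -/
theorem tsum_lossBound_le : ∑' t, (lossBound t : ℝ≥0∞) ≤ ((3 / 4 : ℝ≥0) : ℝ≥0∞) := by
  have hgeo : HasSum (fun t : ℕ => (lossBound (t + 11) : ℝ))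
      (1601 * (3 / 7) ^ 11 * (1 - 3 / 7)⁻¹) := by
    have h := (hasSum_geometric_of_lt_one (r := (3 / 7 : ℝ)) (by norm_num) (by norm_num)).mul_left
      (1601 * (3 / 7) ^ 11)
    refine h.congr_fun fun t => ?_
    simp only [lossBound, if_neg (show ¬ t + 11 < 11 by omega)]
    push_cast
    rw [pow_add]
    ring
  have hsum : HasSum (fun t : ℕ => (lossBound t : ℝ)) (1601 * (3 / 7) ^ 11 * (1 - 3 / 7)⁻¹ +
      ∑ t ∈ Finset.range 11, (lossBound t : ℝ)) := (hasSum_nat_add_iff 11).1 hgeo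
  have h2 : (∑' t, lossBound t : ℝ≥0) ≤ 3 / 4 := by
    rw [← NNReal.coe_le_coe, NNReal.coe_tsum, hsum.tsum_eq]
    simp only [Finset.sum_range_succ, Finset.sum_range_zero, lossBound]
    norm_num
  rw [← ENNReal.coe_tsum (NNReal.summable_coe.1 hsum.summable)]
  exact_mod_cast h2

theorem measurable_loss (t : ℕ) : Measurable (loss β β' t) := by
  classical
  refine Finset.measurable_sum _ fun n _ => Finset.measurable_sum _ fun j _ => ?_
  exact Measurable.ite (measurableSet_discrepancy j n)
    ((measurable_of_countable fun b : ℕ => 2 * (b - 2)).comp (measurable_backs t)) measurable_const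

theorem backs_congr {ξ ξ' : ℕ → Mark} {n : ℕ} (h : ∀ i < n, ξ i = ξ' i) :
    backs ξ n = backs ξ' n := by
  have h1 := height_eq ξ n
  have h2 := height_eq ξ' n
  rw [height_congr h] at h1
  omega

theorem dependsOnPast_loss (t : ℕ) : DependsOnPast t (loss β β' t) := by
  intro ξ ξ' h
  unfold loss
  refine Finset.sum_congr rfl fun n hn => Finset.sum_congr rfl fun j hj => ?_
  simp only [Discrepancy, h n (Finset.mem_range.1 hn), h j (Finset.mem_range.1 hj), backs_congr h]
  congr

theorem setLIntegral_loss_le (hβ : 717 ≤ β) (t : ℕ) :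
    ∫⁻ ξ in {ξ | IsBlock ξ t}, (loss β β' t ξ : ℝ≥0∞) ∂noiseLaw p β ≤
      ((2 * (1 / (1 + β)) : ℝ≥0) : ℝ≥0∞) * meanSepProb p β β' * lossBound t := by
  classical
  -- A positive loss needs three flags, and `IsBlock.le_backs` gives at least `(t - 1) / 3` of them;
  -- rounded up, this is `(t + 1) / 3` in natural division.
  set M := max 3 ((t + 1) / 3)
  let c : ℝ≥0 := 2 * (t - 2 : ℕ) * (2 / (1 + β)) ^ M
  let G : ℕ → ℕ → (ℕ → Mark) → ℝ≥0∞ := fun n j ξ => (if Discrepancy β β' ξ j n then 1 else 0) *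
    ∏ i ∈ Finset.range t, backWeight β (ξ i).1.1
  have hG : ∀ n j, Measurable (G n j) := fun n j =>
    (Measurable.ite (measurableSet_discrepancy j n) measurable_const measurable_const).mul
      (Finset.measurable_prod _ fun i _ =>
        (measurable_of_countable (backWeight β)).comp (measurable_back i))
  have hpt : ∀ ξ, IsBlock ξ t → (loss β β' t ξ : ℝ≥0∞) ≤
      ∑ n ∈ Finset.range t, ∑ j ∈ Finset.range t, (c : ℝ≥0∞) * G n j ξ := by
    intro ξ hξ
    unfold loss
    simp only [Nat.cast_sum]
    refine Finset.sum_le_sum fun n _ => Finset.sum_le_sum fun j _ => ?_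
    by_cases hd : Discrepancy β β' ξ j n
    · rcases Nat.lt_or_ge (backs ξ t) 3 with hb | hb
      · have : backs ξ t - 2 = 0 := by omega
        simp [this]
      · have hM : M ≤ backs ξ t := by
          have := hξ.le_backs
          exact max_le hb (by omega)
        have h1 := indicator_le_backs hβ ξ hM
        have h2 : ((2 * (backs ξ t - 2) : ℕ) : ℝ≥0∞) ≤ ((2 * (t - 2) : ℕ) : ℝ≥0∞) := by
          have := backs_le ξ t
          exact_mod_cast (by omega : 2 * (backs ξ t - 2) ≤ 2 * (t - 2))
        simp only [G, if_pos hd, one_mul]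
        calc ((2 * (backs ξ t - 2) : ℕ) : ℝ≥0∞) ≤ ((2 * (t - 2) : ℕ) : ℝ≥0∞) * 1 := by
              rw [mul_one]; exact h2
          _ ≤ ((2 * (t - 2) : ℕ) : ℝ≥0∞) * ((((2 / (1 + β) : ℝ≥0) : ℝ≥0∞) ^ M) *
                ∏ i ∈ Finset.range t, backWeight β (ξ i).1.1) := by gcongr
          _ = _ := by
              rw [← mul_assoc]
              congr 1
              simp only [c]
              push_cast
              rfl
    · simp [hd]
  calc ∫⁻ ξ in {ξ | IsBlock ξ t}, (loss β β' t ξ : ℝ≥0∞) ∂noiseLaw p β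
      ≤ ∫⁻ ξ in {ξ | IsBlock ξ t}, ∑ n ∈ Finset.range t, ∑ j ∈ Finset.range t,
          (c : ℝ≥0∞) * G n j ξ ∂noiseLaw p β :=
        setLIntegral_mono' (measurableSet_isBlock t) hpt
    _ ≤ ∫⁻ ξ, ∑ n ∈ Finset.range t, ∑ j ∈ Finset.range t,
          (c : ℝ≥0∞) * G n j ξ ∂noiseLaw p β := setLIntegral_le_lintegral _ _
    _ = ∑ n ∈ Finset.range t, ∑ j ∈ Finset.range t, (c : ℝ≥0∞) * ∫⁻ ξ, G n j ξ ∂noiseLaw p β := by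
        rw [lintegral_finsetSum _ fun n _ => Finset.measurable_sum _ fun j _ =>
          (hG n j).const_mul _]
        refine Finset.sum_congr rfl fun n _ => ?_
        rw [lintegral_finsetSum _ fun j _ => (hG n j).const_mul _]
        exact Finset.sum_congr rfl fun j _ => lintegral_const_mul _ (hG n j)
    _ ≤ ∑ n ∈ Finset.range t, ∑ j ∈ Finset.range t, (c : ℝ≥0∞) *
          (meanSepProb p β β' * (((1 / 3 : ℝ≥0) : ℝ≥0∞) * ((3 / 2 : ℝ≥0) : ℝ≥0∞) ^ t)) := by
        refine Finset.sum_le_sum fun n hn => Finset.sum_le_sum fun j hj => ?_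
        gcongr
        exact lintegral_discrepancy_le p t (Finset.mem_range.1 hj) (Finset.mem_range.1 hn)
    _ = ((t * t * c * (1 / 3 * (3 / 2) ^ t) : ℝ≥0) : ℝ≥0∞) * meanSepProb p β β' := by
        simp only [Finset.sum_const, Finset.card_range, nsmul_eq_mul]
        push_cast
        ring
    _ = ((2 * (1 / (1 + β)) * (2 / 3 * (t - 2 : ℕ) * t ^ 2 * (3 / 2) ^ t *
          (2 / (1 + β)) ^ (M - 1)) : ℝ≥0) : ℝ≥0∞) * meanSepProb p β β' := by
        congr 2
        -- One of the `M` factors `2 / (1 + β)` is split off, since the expected gain carries it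
        -- too.
        obtain ⟨m, hm⟩ : ∃ m, M = m + 1 := Nat.exists_eq_add_of_le' (by omega)
        simp only [c, hm, Nat.add_sub_cancel, pow_succ]
        field_simp
    _ ≤ ((2 * (1 / (1 + β)) * lossBound t : ℝ≥0) : ℝ≥0∞) * meanSepProb p β β' := by
        gcongr
        exact le_lossBound hβ t
    _ = _ := by push_cast; ring

theorem lintegral_loss_le (hβ : 717 ≤ β) :
    ∫⁻ ξ, ((atRegen (loss β β') ξ : ℕ) : ℝ≥0∞) ∂stayLaw p β ≤
      ((2 * (1 / (1 + β)) * (3 / 4) : ℝ≥0) : ℝ≥0∞) * meanSepProb p β β' := by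
  rw [lintegral_atRegen p hβ measurable_loss dependsOnPast_loss]
  calc _ ≤ ∑' t, ((2 * (1 / (1 + β)) : ℝ≥0) : ℝ≥0∞) * meanSepProb p β β' * lossBound t :=
        ENNReal.tsum_le_tsum (setLIntegral_loss_le p hβ)
    _ ≤ ((2 * (1 / (1 + β)) : ℝ≥0) : ℝ≥0∞) * meanSepProb p β β' * ((3 / 4 : ℝ≥0) : ℝ≥0∞) := by
        rw [ENNReal.tsum_mul_left]
        gcongr
        exact tsum_lossBound_le
    _ = _ := by push_cast; ring

open Classical in
/-- The distance gained by the faster walk in blocks of length four. -/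
def gain (β β' : ℝ≥0) (t : ℕ) (ξ : ℕ → Mark) : ℕ := if t = 4 ∧ GainBlock β β' ξ then 2 else 0

theorem measurableSet_gainBlock : MeasurableSet {ξ | GainBlock β β' ξ} :=
  (measurable_back 0 (measurableSet_singleton false)).inter
    ((measurableSet_discrepancy 1 1).inter
      ((measurable_back 2 (measurableSet_singleton false)).inter
        (measurable_back 3 (measurableSet_singleton false))))

theorem measurable_gain (t : ℕ) : Measurable (gain β β' t) := by
  classical
  exact Measurable.ite ((MeasurableSet.const _).inter measurableSet_gainBlock) measurable_const
    measurable_const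

theorem dependsOnPast_gain (t : ℕ) : DependsOnPast t (gain β β' t) := by
  intro ξ ξ' h
  unfold gain
  by_cases ht : t = 4
  · subst ht
    simp only [GainBlock, Discrepancy, h 0 (by omega), h 1 (by omega), h 2 (by omega),
      h 3 (by omega)]
  · simp [ht]

/-- Only blocks of length four contribute, and `GainBlock` already implies that the first four steps
form a block. -/
theorem lintegral_gain (hβ : 717 ≤ β) :
    ∫⁻ ξ, ((atRegen (gain β β') ξ : ℕ) : ℝ≥0∞) ∂stayLaw p β =
      2 * (((β / (1 + β) : ℝ≥0) : ℝ≥0∞) ^ 3 *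
        (((1 / (1 + β) : ℝ≥0) : ℝ≥0∞) * meanSepProb p β β')) := by
  classical
  rw [lintegral_atRegen p hβ measurable_gain dependsOnPast_gain,
    tsum_eq_single 4 fun t ht => by simp [gain, ht], ← noiseLaw_gainBlock]
  have h1 : ∀ ξ, ((gain β β' 4 ξ : ℕ) : ℝ≥0∞) =
      {ξ | GainBlock β β' ξ}.indicator (fun _ => 2) ξ := fun ξ => by
    by_cases hg : GainBlock β β' ξ <;> simp [gain, Set.indicator, hg]
  simp_rw [h1]
  rw [lintegral_indicator_const measurableSet_gainBlock,
    Measure.restrict_apply measurableSet_gainBlock]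
  congr 2
  exact Set.inter_eq_left.2 fun ξ hξ => GainBlock.isBlock hξ

theorem depth_add_gain_le (h : β ≤ β') (ξ : ℕ → Mark) (t : ℕ) :
    depth β β ξ t + gain β β' t ξ ≤ depth β β' ξ t + loss β β' t ξ := by
  unfold gain
  split_ifs with hg
  · obtain ⟨rfl, hg⟩ := hg
    rw [hg.depth_eq]
    omega
  · exact depth_le_add_loss h ξ t

theorem lintegral_depth_lt (hβ : 717 ≤ β) (h : β < β') :
    ∫⁻ ξ, (depth β β ξ (regenTime ξ) : ℝ≥0∞) ∂stayLaw p β <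
      ∫⁻ ξ, (depth β β' ξ (regenTime ξ) : ℝ≥0∞) ∂stayLaw p β := by
  have hm : ∀ {f : ℕ → (ℕ → Mark) → ℕ}, (∀ t, Measurable (f t)) →
      Measurable fun ξ => ((atRegen f ξ : ℕ) : ℝ≥0∞) := fun hf =>
    (measurable_of_countable fun n : ℕ => (n : ℝ≥0∞)).comp (measurable_atRegen hf)
  have hle : ∫⁻ ξ, (depth β β ξ (regenTime ξ) : ℝ≥0∞) ∂stayLaw p β +
      ∫⁻ ξ, ((atRegen (gain β β') ξ : ℕ) : ℝ≥0∞) ∂stayLaw p β ≤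
      ∫⁻ ξ, (depth β β' ξ (regenTime ξ) : ℝ≥0∞) ∂stayLaw p β +
      ∫⁻ ξ, ((atRegen (loss β β') ξ : ℕ) : ℝ≥0∞) ∂stayLaw p β := by
    rw [← lintegral_add_right _ (hm measurable_gain), ← lintegral_add_right _ (hm measurable_loss)]
    refine lintegral_mono fun ξ => ?_
    have h1 := depth_add_gain_le h.le ξ (regenTime ξ)
    simp only [atRegen]
    exact_mod_cast h1
  have hlt : ∫⁻ ξ, ((atRegen (loss β β') ξ : ℕ) : ℝ≥0∞) ∂stayLaw p β <
      ∫⁻ ξ, ((atRegen (gain β β') ξ : ℕ) : ℝ≥0∞) ∂stayLaw p β := by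
    refine (lintegral_loss_le p hβ).trans_lt ?_
    have e : 2 * (((β / (1 + β) : ℝ≥0) : ℝ≥0∞) ^ 3 *
        (((1 / (1 + β) : ℝ≥0) : ℝ≥0∞) * meanSepProb p β β')) =
        ((2 * (1 / (1 + β)) * (β / (1 + β)) ^ 3 : ℝ≥0) : ℝ≥0∞) * meanSepProb p β β' := by
      push_cast; ring
    rw [lintegral_gain p hβ, e]
    -- The common factor `meanSepProb` is positive and finite and cancels; with `2 / (1 + β)`
    -- removed as well, `3 / 4 < (β / (1 + β)) ^ 3` remains.
    refine (ENNReal.mul_lt_mul_iff_left (meanSepProb_ne_zero p h) (meanSepProb_ne_top p)).2 ?_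
    rw [ENNReal.coe_lt_coe]
    refine mul_lt_mul_of_pos_left ?_ (by positivity)
    have hb : (717 : ℝ) ≤ β := by exact_mod_cast hβ
    have h1 : (99 / 100 : ℝ≥0) ≤ β / (1 + β) := by
      rw [div_le_div_iff₀ (by norm_num) (by positivity), ← NNReal.coe_le_coe]
      push_cast
      linarith
    calc (3 / 4 : ℝ≥0) < (99 / 100) ^ 3 := by
          rw [← NNReal.coe_lt_coe]; push_cast; norm_num
      _ ≤ _ := by gcongr
  have htop : ∫⁻ ξ, (depth β β' ξ (regenTime ξ) : ℝ≥0∞) ∂stayLaw p β ≠ ∞ :=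
    ne_top_of_le_ne_top (lintegral_regenTime_ne_top p hβ)
      (lintegral_mono fun ξ => Nat.cast_le.2 (depth_le ξ (regenTime ξ)))
  by_contra! hcon
  have := (add_le_add_left hcon _).trans hle
  exact absurd (ENNReal.le_of_add_le_add_left htop this) (not_le.2 hlt)

theorem integral_depth_lt (hβ : 717 ≤ β) (h : β < β') :
    ∫ ξ, (depth β β ξ (regenTime ξ) : ℝ) ∂stayLaw p β <
      ∫ ξ, (depth β β' ξ (regenTime ξ) : ℝ) ∂stayLaw p β := by
  have hI : ∀ b : ℝ≥0, ENNReal.ofReal (∫ ξ, (depth β b ξ (regenTime ξ) : ℝ) ∂stayLaw p β) =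
      ∫⁻ ξ, (depth β b ξ (regenTime ξ) : ℝ≥0∞) ∂stayLaw p β := fun b => by
    rw [ofReal_integral_eq_lintegral_ofReal (integrable_depth_regenTime p b hβ)
      (ae_of_all _ fun ξ => by positivity)]
    simp
  have := lintegral_depth_lt p hβ h
  rw [← hI, ← hI] at this
  exact (ENNReal.ofReal_lt_ofReal_iff'.1 this).1

theorem isSpeed_lazy (hp : p 0 = 0) (hβ : 717 ≤ β) (h : β ≤ β') :
    IsSpeed p β' ((∫ ξ, (depth β β' ξ (regenTime ξ) : ℝ) ∂stayLaw p β) /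
      ∫ ξ, (regenTime ξ : ℝ) ∂stayLaw p β) :=
  isSpeed_of_noiseLaw hp h (tendsto_depth_div_noiseLaw p β' hβ)

theorem IsSpeed.unique {v w : ℝ} (hv : IsSpeed p β v) (hw : IsSpeed p β w) : v = w := by
  obtain ⟨z, h1, h2⟩ := (hv.and hw).exists
  exact tendsto_nhds_unique h1 h2

end Monotonicity

end BiasedGW

end

/-- On Galton–Watson trees without leaves, the almost sure speed of the `β`-biased walk exists and
is strictly increasing in `β` on `[717, ∞)`. -/
theorem theorem1 (p : PMF ℕ) (hp : p 0 = 0) :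
    ∃ v : ℝ≥0 → ℝ, (∀ β : ℝ≥0, 717 ≤ β → BiasedGW.IsSpeed p β (v β)) ∧
      StrictMonoOn v (Set.Ici 717) := by
  refine ⟨fun β => (∫ ξ, (BiasedGW.depth β β ξ (BiasedGW.regenTime ξ) : ℝ)
    ∂BiasedGW.stayLaw p β) / ∫ ξ, (BiasedGW.regenTime ξ : ℝ) ∂BiasedGW.stayLaw p β,
    fun β hβ => BiasedGW.isSpeed_lazy p hp hβ le_rfl, fun β hβ β' hβ' h => ?_⟩
  have h1 := BiasedGW.isSpeed_lazy p hp hβ h.le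
  have h2 := BiasedGW.isSpeed_lazy p hp hβ' le_rfl
  beta_reduce
  -- The value at `β'` is defined through the noise with parameter `β'`. Uniqueness of the speed
  -- re-expresses it through the noise with parameter `β`, which makes the denominators equal.
  rw [BiasedGW.IsSpeed.unique p h2 h1]
  have := BiasedGW.one_le_integral_regenTime p hβ
  exact div_lt_div_of_pos_right (BiasedGW.integral_depth_lt p hβ h) (by linarith)
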